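/- Let $V=\{1,\dots,N\}$ ($N\ge 1$) be a set of agents on the vertices of an undirected graph $G$, let $A=\{1,\dots,K\}$ ($K\ge 1$) be the set of actions, and let each agent $v$ have a delay $d(v)\in\{0,1,2,\dots\}$ and a time-to-live $ttl(v)\in\{0,1,2,\dots\}$. Let $G_{\mathcal P}$ be the directed graph on $V$ with an arc $(v',v)$ if and only if $\mathrm{dist}_G(v',v)\le\min\{d(v),ttl(v')\}$ (so all self-loops are present); let $N^-_{\mathcal P}(v)$ be the in-neighbourhood of $v$ in it and $\alpha(G_{\mathcal P})$ the independence number of the undirected graph obtained from it by disregarding orientation. Let $\bar d_V=\frac1N\sum_{v\in V}d(v)$. Exp3-Coop2 with learning rate $\eta>0$ and exploration parameter $\delta>0$ sets $w_1(i,v)=1$ and, in round $t=1,2,\dots$, every agent $v$ draws (independently of the other agents, given the past) an action $I_t(v)$ from $$p_t(i,v)=\frac{\widetilde p_t(i,v)}{\sum_{j\in A}\widetilde p_t(j,v)},\qquad \widetilde p_t(i,v)=\max\Big\{\frac{w_t(i,v)}{\sum_{j\in A} w_t(j,v)},\frac{\delta}{K}\Big\},$$ and then sets $w_{t+1}(i,v)=p_t(i,v)\,e^{-\eta\,\widehat\ell_t(i,v)}$,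 where $\widehat\ell_t(i,v)=0$ if $t\le d(v)$ and otherwise, with $s=t-d(v)$, $$\widehat\ell_t(i,v)=\frac{\ell_s(i)}{q_s(i,v)}\,\mathbb 1\{\exists v'\in N^-_{\mathcal P}(v): I_s(v')=i\},\qquad q_s(i,v)=1-\prod_{v'\in N^-_{\mathcal P}(v)}\big(1-p_s(i,v')\big).$$ The losses $\ell_t(i)\in[0,1]$ are fixed in advance (oblivious adversary). The average welfare regret is $$R_T^{\mathrm{coop}}=\frac1N\sum_{v\in V}\mathbb E\Big[\sum_{t=1}^T\ell_t(I_t(v))\Big]-\min_{i\in A}\sum_{t=1}^T\ell_t(i).$$ Theorem. There is an absolute constant $C>0$ such that for all $K$, $N$, $G$, $\{d(v),ttl(v)\}_{v\in V}$ as above and all learning rates $\eta=\eta(T)>0$ with $\eta(T)\to0$ as $T\to\infty$, there is a $T_0$ such that for all $T\ge T_0$ and all loss sequences with values in $[0,1]$, Exp3-Coop2 run with learning rate $\eta=\eta(T)$ and exploration parameter $\delta=1/T$ satisfies $$R_T^{\mathrm{coop}}\le C\left(\frac{\ln K}{\eta}+\eta\Big(\bar d_V+\frac KN\,\alpha(G_{\mathcal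 P})\ln(TNK)\Big)T\right).$$ -/

import Mathlib

open Filter Topology

namespace Exp3Coop2

/-! Agents are the elements of `V`, actions the elements of `A`.  Rounds are numbered
`0, 1, 2, …` (a run over `T` rounds uses the rounds `0, …, T - 1`), so "round `s` is at
least `d` rounds old at round `t`" reads `d ≤ t`, with `s = t - d`. -/

/-- The directed communication graph induced by the individual delays `d` and the individual
times-to-live `ttl`: there is an arc from `v'` to `v` iff the shortest-path distance between
them in `G` is at most `min (d v) (ttl v')`.  (The extended distance is `⊤` between different
components of `G`.)  All self-loops are present. -/
noncomputable def commDigraph {V : Type*} (G : SimpleGraph V) (d ttl : V → ℕ) : Digraph V where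
  Adj v' v := G.edist v' v ≤ ((min (d v) (ttl v') : ℕ) : ℕ∞)

/-- Independence number of a directed graph: the independence number of the undirected graph
obtained by disregarding the orientation of the arcs (and the self-loops). -/
noncomputable def digraphIndepNum {V : Type*} (D : Digraph V) : ℕ :=
  D.toSimpleGraphInclusive.indepNum

open scoped Classical in
/-- The in-neighbourhood of `v`. -/
noncomputable def inNeighbors {V : Type*} [Fintype V] (D : Digraph V) (v : V) : Finset V :=
  Finset.univ.filter fun v' => D.Adj v' v

/-- `max {w i / ∑ j, w j, δ / K}`, where `K` is the number of actions. -/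
noncomputable def truncated {A : Type*} [Fintype A] (δ : ℝ) (w : A → ℝ) (i : A) : ℝ :=
  max (w i / ∑ j, w j) (δ / Fintype.card A)

/-- The distribution over actions computed from the weights `w`: the truncated normalized weights,
normalized again. -/
noncomputable def actionDist {A : Type*} [Fintype A] (δ : ℝ) (w : A → ℝ) (i : A) : ℝ :=
  truncated δ w i / ∑ j, truncated δ w j

/-- `1 - ∏ (1 - p v' i)` over the in-neighbours `v'` of `v`: the probability that some in-neighbour
of `v` plays `i`, when each agent `v'` draws its action from `p v'` independently. -/
noncomputable def observeProb {V A : Type*} [Fintype V] (D : Digraph V) (p : V → A → ℝ)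
    (v : V) (i : A) : ℝ :=
  1 - ∏ v' ∈ inNeighbors D v, (1 - p v' i)

open scoped Classical in
/-- Indicator that some in-neighbour of `v` plays `i`, when agent `v'` plays `x v'`. -/
noncomputable def observed {V A : Type*} [Fintype V] (D : Digraph V) (x : V → A)
    (v : V) (i : A) : ℝ :=
  if ∃ v' ∈ inNeighbors D v, x v' = i then 1 else 0

/-- The weight of action `i` for agent `v` in round `t`, when the actions played are given by `I`
(agent `v` plays `I s v` in round `s`), the losses by `ℓ` (action `i` has loss `ℓ s i` in round `s`),
with communication digraph `D`, delays `d`, learning rate `η` and exploration parameter `δ`.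
See `weight_zero` and `weight_succ` for the update rule in terms of `prob` and `lossEst`. -/
noncomputable def weight {V A : Type*} [Fintype V] [Fintype A] (D : Digraph V) (d : V → ℕ)
    (η δ : ℝ) (ℓ : ℕ → A → ℝ) (I : ℕ → V → A) : ℕ → V → A → ℝ
  | 0, _, _ => 1
  | t + 1, v, i =>
      actionDist δ (fun j => weight D d η δ ℓ I t v j) i *
        Real.exp (-η *
          (if d v ≤ t then
            ℓ (t - d v) i /
              observeProb D
                (fun v' => actionDist δ (fun j => weight D d η δ ℓ I (t - d v) v' j)) v i *
              observed D (I (t - d v)) v i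
          else 0))
termination_by t => t

/-- The probability with which agent `v` plays action `i` in round `t`. -/
noncomputable def prob {V A : Type*} [Fintype V] [Fintype A] (D : Digraph V) (d : V → ℕ)
    (η δ : ℝ) (ℓ : ℕ → A → ℝ) (I : ℕ → V → A) (t : ℕ) (v : V) (i : A) : ℝ :=
  actionDist δ (weight D d η δ ℓ I t v) i

/-- The delayed importance-weighted loss estimate that agent `v` uses in round `t`. -/
noncomputable def lossEst {V A : Type*} [Fintype V] [Fintype A] (D : Digraph V) (d : V → ℕ)
    (η δ : ℝ) (ℓ : ℕ → A → ℝ) (I : ℕ → V → A) (t : ℕ) (v : V) (i : A) : ℝ :=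
  if d v ≤ t then
    ℓ (t - d v) i / observeProb D (prob D d η δ ℓ I (t - d v)) v i * observed D (I (t - d v)) v i
  else 0

theorem weight_zero {V A : Type*} [Fintype V] [Fintype A] (D : Digraph V) (d : V → ℕ)
    (η δ : ℝ) (ℓ : ℕ → A → ℝ) (I : ℕ → V → A) (v : V) (i : A) :
    weight D d η δ ℓ I 0 v i = 1 := by
  rw [weight]

/-- The update rule. -/
theorem weight_succ {V A : Type*} [Fintype V] [Fintype A] (D : Digraph V) (d : V → ℕ)
    (η δ : ℝ) (ℓ : ℕ → A → ℝ) (I : ℕ → V → A) (t : ℕ) (v : V) (i : A) :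
    weight D d η δ ℓ I (t + 1) v i =
      prob D d η δ ℓ I t v i * Real.exp (-η * lossEst D d η δ ℓ I t v i) := by
  rw [weight]
  rfl

/-- The actions of the rounds `0, …, T - 1`, extended by an arbitrary action to all later rounds
(no action of a round `≥ T` is ever used). -/
noncomputable def extend {V A : Type*} [Nonempty A] {T : ℕ} (a : Fin T → V → A) : ℕ → V → A :=
  fun t v => if h : t < T then a ⟨t, h⟩ v else Classical.arbitrary A

/-- The probability that the actions of the rounds `0, …, T - 1` are `a`: in each round, given the
past, the agents draw their actions independently from their current distributions. -/
noncomputable def trajProb {V A : Type*} [Fintype V] [Fintype A] [Nonempty A] (D : Digraph V)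
    (d : V → ℕ) (η δ : ℝ) (ℓ : ℕ → A → ℝ) (T : ℕ) (a : Fin T → V → A) : ℝ :=
  ∏ t : Fin T, ∏ v : V, prob D d η δ ℓ (extend a) t v (a t v)

/-- Expectation of a function of the actions of the rounds `0, …, T - 1`. -/
noncomputable def expect {V A : Type*} [Fintype V] [DecidableEq V] [Fintype A] [Nonempty A]
    (D : Digraph V) (d : V → ℕ) (η δ : ℝ) (ℓ : ℕ → A → ℝ) (T : ℕ)
    (F : (Fin T → V → A) → ℝ) : ℝ :=
  ∑ a : Fin T → V → A, trajProb D d η δ ℓ T a * F a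

/-- The average welfare regret after `T` rounds. -/
noncomputable def welfareRegret {V A : Type*} [Fintype V] [DecidableEq V] [Fintype A] [Nonempty A]
    (D : Digraph V) (d : V → ℕ) (η δ : ℝ) (ℓ : ℕ → A → ℝ) (T : ℕ) : ℝ :=
  (1 / (Fintype.card V : ℝ)) *
      ∑ v : V, expect D d η δ ℓ T (fun a => ∑ t : Fin T, ℓ t (a t v)) -
    ⨅ i : A, ∑ t ∈ Finset.range T, ℓ t i

/-- The average delay. -/
noncomputable def avgDelay {V : Type*} [Fintype V] (d : V → ℕ) : ℝ :=
  (1 / (Fintype.card V : ℝ)) * ∑ v : V, (d v : ℝ)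

/-! The probabilities `prob` and `trajProb` are indeed probabilities. -/

theorem truncated_pos {A : Type*} [Fintype A] [Nonempty A] {δ : ℝ} (hδ : 0 < δ) (w : A → ℝ)
    (i : A) : 0 < truncated δ w i :=
  lt_max_of_lt_right (div_pos hδ (by exact_mod_cast Fintype.card_pos))

theorem prob_pos {V A : Type*} [Fintype V] [Fintype A] [Nonempty A] (D : Digraph V)
    (d : V → ℕ) (η : ℝ) {δ : ℝ} (hδ : 0 < δ) (ℓ : ℕ → A → ℝ) (I : ℕ → V → A) (t : ℕ) (v : V)
    (i : A) : 0 < prob D d η δ ℓ I t v i :=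
  div_pos (truncated_pos hδ _ _)
    (Finset.sum_pos (fun _ _ => truncated_pos hδ _ _) Finset.univ_nonempty)

theorem sum_prob {V A : Type*} [Fintype V] [Fintype A] [Nonempty A] (D : Digraph V)
    (d : V → ℕ) (η : ℝ) {δ : ℝ} (hδ : 0 < δ) (ℓ : ℕ → A → ℝ) (I : ℕ → V → A) (t : ℕ) (v : V) :
    ∑ i, prob D d η δ ℓ I t v i = 1 := by
  unfold prob actionDist
  rw [← Finset.sum_div]
  exact div_self
    (Finset.sum_pos (fun _ _ => truncated_pos hδ _ _) Finset.univ_nonempty).ne'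

/-- The weights of round `t` depend only on the actions of the earlier rounds. -/
theorem weight_congr {V A : Type*} [Fintype V] [Fintype A] (D : Digraph V)
    (d : V → ℕ) (η δ : ℝ) (ℓ : ℕ → A → ℝ) (I J : ℕ → V → A) (t : ℕ)
    (h : ∀ s, s < t → I s = J s) : weight D d η δ ℓ I t = weight D d η δ ℓ J t := by
  induction t using Nat.strong_induction_on with
  | _ t ih =>
    funext v i
    cases t with
    | zero => rw [weight_zero, weight_zero]
    | succ t =>
      have h1 := ih t (by omega) (fun s hs => h s (by omega))
      have h2 := ih (t - d v) (by omega) (fun s hs => h s (by omega))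
      have h3 := h (t - d v) (by omega)
      rw [weight_succ, weight_succ]
      unfold lossEst
      have h4 : prob D d η δ ℓ I t = prob D d η δ ℓ J t := by
        funext v i; unfold prob; rw [h1]
      have h5 : prob D d η δ ℓ I (t - d v) = prob D d η δ ℓ J (t - d v) := by
        funext v i; unfold prob; rw [h2]
      rw [h3, h4, h5]

theorem trajProb_nonneg {V A : Type*} [Fintype V] [Fintype A] [Nonempty A] (D : Digraph V)
    (d : V → ℕ) (η : ℝ) {δ : ℝ} (hδ : 0 < δ) (ℓ : ℕ → A → ℝ) (T : ℕ) (a : Fin T → V → A) :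
    0 ≤ trajProb D d η δ ℓ T a :=
  Finset.prod_nonneg fun _ _ => Finset.prod_nonneg fun _ _ => (prob_pos D d η hδ ℓ _ _ _ _).le

theorem sum_trajProb {V A : Type*} [Fintype V] [DecidableEq V] [Fintype A] [Nonempty A]
    (D : Digraph V) (d : V → ℕ) (η : ℝ) {δ : ℝ} (hδ : 0 < δ) (ℓ : ℕ → A → ℝ) (T : ℕ) :
    ∑ a : Fin T → V → A, trajProb D d η δ ℓ T a = 1 := by
  induction T with
  | zero => simp [trajProb]
  | succ T ih =>
    have key : ∀ (x : V → A) (a : Fin T → V → A),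
        trajProb D d η δ ℓ (T + 1) (Fin.snoc (α := fun _ => V → A) a x) =
          trajProb D d η δ ℓ T a * ∏ v, prob D d η δ ℓ (extend a) T v (x v) := by
      intro x a
      have hp : ∀ t, t ≤ T →
          prob D d η δ ℓ (extend (Fin.snoc (α := fun _ => V → A) a x)) t =
            prob D d η δ ℓ (extend a) t := by
        intro t ht
        have hw := weight_congr D d η δ ℓ
          (extend (Fin.snoc (α := fun _ => V → A) a x)) (extend a) t (by
            intro s hs
            funext v
            have hsT : s < T := by omega
            simp [extend, hsT, Nat.lt_succ_of_lt hsT, Fin.snoc])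
        funext v i
        unfold prob
        rw [hw]
      unfold trajProb
      rw [Fin.prod_univ_castSucc]
      congr 1
      · refine Finset.prod_congr rfl fun t _ => Finset.prod_congr rfl fun v _ => ?_
        rw [Fin.val_castSucc, hp t t.2.le, Fin.snoc_castSucc]
      · refine Finset.prod_congr rfl fun v _ => ?_
        rw [Fin.val_last, hp T le_rfl, Fin.snoc_last]
    rw [← (Fin.snocEquiv (fun _ : Fin (T + 1) => V → A)).sum_comp, Fintype.sum_prod_type_right]
    have hone : ∀ a : Fin T → V → A,
        ∑ x : V → A, ∏ v, prob D d η δ ℓ (extend a) T v (x v) = 1 := by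
      intro a
      rw [← Fintype.prod_sum]
      exact Finset.prod_eq_one fun v _ => sum_prob D d η hδ ℓ _ T v
    calc _ = ∑ a : Fin T → V → A, trajProb D d η δ ℓ T a *
          ∑ x : V → A, ∏ v, prob D d η δ ℓ (extend a) T v (x v) := by
            refine Finset.sum_congr rfl fun a _ => ?_
            rw [Finset.mul_sum]
            exact Finset.sum_congr rfl fun x _ => key x a
      _ = 1 := by simp only [hone, mul_one, ih]

end Exp3Coop2

/-! Each agent runs exponential weights on delayed importance-weighted losses. The logarithm of its
probability of a fixed action is a potential that starts at minus the log of the number of actions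
and never exceeds zero. Telescoping it bounds the estimated regret by a second-moment term, plus `δ`
per round for the truncation (`sum_prob_mul_lossEst_le`).

Expectations are tractable because an agent with delay `d` has, at round `s + d`, a distribution
determined by the rounds before `s` (`dependsOn_prob_add_delay`). The draws of round `s` can
therefore be averaged out with that distribution frozen. The estimates are unbiased, and one factor
`1 / q` survives in the second moment. Passing from the distribution played at `s` to the one at `s
+ d` costs `δ + η` in expectation per round of delay (`pathExpect_drift_le`), and feedback arriving
after the horizon costs at most `d`; this produces the average delay.

The second moment pairs `p` at `s + d` with `q` at `s`. If `η` and `δ` are small compared with the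
inverse of the maximal delay, probabilities at most double over a delay (`prob_add_le_two_mul`), so
`p / q` at the single round `s` remains. Its sum over agents is bounded graph-theoretically by the
independence number times a logarithm (`sum_div_observeProb_le`): cooperation pays because agents in
a dense neighbourhood share observations.

For large `T` the leftover constants fit into the main terms, except when there is one action, where
the regret vanishes. -/

namespace Exp3Coop2

/-! ### Independence number and weighted in-neighbourhoods -/

open scoped Classical in
/-- Weighted Caro–Wei bound. -/
theorem exists_isIndepSet_sum_div_le {V : Type*} (H : SimpleGraph V) {w : V → ℝ}
    (hw : ∀ v, 0 < w v) (S : Finset V) :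
    ∃ t ⊆ S, H.IsIndepSet t ∧
      ∑ v ∈ S, w v / ∑ u ∈ S with u = v ∨ H.Adj u v, w u ≤ t.card := by
  induction S using Finset.strongInduction with
  | H S ih =>
    obtain rfl | hS := S.eq_empty_or_nonempty
    · exact ⟨∅, by simp⟩
    set P : V → ℝ := fun v => ∑ u ∈ S with u = v ∨ H.Adj u v, w u with hP
    -- Greedy choice: delete the closed neighbourhood of least mass. Its vertices all have `P u ≥ P
    -- v`, which is its own mass, so together they contribute at most 1. Deletion shrinks the
    -- remaining denominators, so the induction hypothesis dominates the rest.
    obtain ⟨v, hv, hmin⟩ := S.exists_min_image P hS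
    set N := S.filter (fun u => u = v ∨ H.Adj u v) with hN
    have hvN : v ∈ N := by simp [hN, hv]
    have hss : S \ N ⊂ S :=
      Finset.sdiff_ssubset (Finset.filter_subset _ _) ⟨v, hvN⟩
    obtain ⟨t, ht, hti, hts⟩ := ih (S \ N) hss
    have hvt : v ∉ t := fun h => (Finset.mem_sdiff.1 (ht h)).2 hvN
    have hPpos : ∀ u ∈ S, 0 < P u := fun u hu =>
      Finset.sum_pos (fun x _ => hw x) ⟨u, by simp [hu]⟩
    refine ⟨insert v t, ?_, ?_, ?_⟩
    · exact Finset.insert_subset hv (ht.trans hss.subset)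
    · rw [Finset.coe_insert]
      refine hti.insert fun u hu _ => ?_
      have h := Finset.mem_sdiff.1 (ht hu)
      have hadj : ¬ H.Adj u v := fun hadj => h.2 (Finset.mem_filter.2 ⟨h.1, Or.inr hadj⟩)
      exact ⟨fun h => hadj h.symm, hadj⟩
    · rw [Finset.card_insert_of_notMem hvt, ← Finset.sum_sdiff (Finset.filter_subset _ S : N ⊆ S)]
      push_cast
      refine add_le_add (le_trans (Finset.sum_le_sum fun u hu => ?_) hts) ?_
      · refine div_le_div_of_nonneg_left (hw u).le
          (Finset.sum_pos (fun x _ => hw x) ⟨u, Finset.mem_filter.2 ⟨hu, Or.inl rfl⟩⟩) ?_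
        exact Finset.sum_le_sum_of_subset_of_nonneg
          (Finset.filter_subset_filter _ Finset.sdiff_subset) fun x _ _ => (hw x).le
      · calc ∑ u ∈ N, w u / P u ≤ ∑ u ∈ N, w u / P v := by
              refine Finset.sum_le_sum fun u hu => ?_
              exact div_le_div_of_nonneg_left (hw u).le (hPpos v hv)
                (hmin u (Finset.mem_filter.1 hu).1)
          _ = 1 := by
              rw [← Finset.sum_div]
              exact div_self (hPpos v hv).ne'

open scoped Classical in
/-- In every nonempty set of vertices some vertex receives from within the set at least a fraction
`1 / (2 α)` of its total mass. -/
theorem exists_sum_le_indepNum_mul {V : Type*} [Finite V] (D : Digraph V)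
    {w : V → ℝ} (hw : ∀ v, 0 < w v) (hD : ∀ v, D.Adj v v) {S : Finset V} (hS : S.Nonempty) :
    ∃ v ∈ S, ∑ u ∈ S, w u ≤ 2 * digraphIndepNum D * ∑ u ∈ S with D.Adj u v, w u := by
  obtain ⟨t, -, hti, hts⟩ := exists_isIndepSet_sum_div_le D.toSimpleGraphInclusive hw S
  have hα : (t.card : ℝ) ≤ digraphIndepNum D := by exact_mod_cast hti.card_le_indepNum
  set Q : V → ℝ := fun v => ∑ u ∈ S with u = v ∨ D.toSimpleGraphInclusive.Adj u v, w u with hQ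
  set P : V → ℝ := fun v => ∑ u ∈ S with D.Adj u v, w u with hP
  have hQpos : ∀ u ∈ S, 0 < Q u := fun u hu =>
    Finset.sum_pos (fun x _ => hw x) ⟨u, by simp [hu]⟩
  by_contra! hcon
  have hWpos : 0 < ∑ u ∈ S, w u := Finset.sum_pos (fun x _ => hw x) hS
  -- An undirected neighbour is an in- or an out-neighbour, and the weighted totals of in-mass and
  -- out-mass agree by symmetry of the double sum.
  have hQP : ∑ v ∈ S, w v * Q v ≤ 2 * ∑ v ∈ S, w v * P v := by
    have h1 : ∑ v ∈ S, w v * P v = ∑ v ∈ S, ∑ u ∈ S, if D.Adj u v then w v * w u else 0 := by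
      refine Finset.sum_congr rfl fun v _ => ?_
      rw [hP, Finset.mul_sum, Finset.sum_filter]
    have h2 : ∑ v ∈ S, w v * P v = ∑ v ∈ S, ∑ u ∈ S, if D.Adj v u then w v * w u else 0 := by
      rw [h1, Finset.sum_comm]
      simp only [mul_comm]
    rw [two_mul]
    nth_rw 1 [h1]
    rw [h2, ← Finset.sum_add_distrib]
    refine Finset.sum_le_sum fun v _ => ?_
    rw [hQ, Finset.mul_sum, Finset.sum_filter, ← Finset.sum_add_distrib]
    refine Finset.sum_le_sum fun u _ => ?_
    have hp := mul_pos (hw v) (hw u)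
    have hor : (u = v ∨ D.toSimpleGraphInclusive.Adj u v) → D.Adj u v ∨ D.Adj v u := by
      rintro (rfl | h)
      · exact Or.inl (hD _)
      · exact h.2
    by_cases h : u = v ∨ D.toSimpleGraphInclusive.Adj u v
    · rw [if_pos h]
      rcases hor h with h' | h' <;> rw [if_pos h'] <;> split_ifs <;> linarith
    · rw [if_neg h]
      split_ifs <;> linarith
  have hcs : (∑ v ∈ S, w v) ^ 2 ≤ (∑ v ∈ S, w v * Q v) * ∑ v ∈ S, w v / Q v := by
    refine Finset.sum_sq_le_sum_mul_sum_of_sq_le_mul S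
      (fun v hv => (mul_pos (hw v) (hQpos v hv)).le)
      (fun v hv => (div_pos (hw v) (hQpos v hv)).le) fun v hv => ?_
    have := (hQpos v hv).ne'
    exact le_of_eq (by field_simp)
  have hPnn : 0 ≤ ∑ v ∈ S, w v * P v := Finset.sum_nonneg fun v _ =>
    mul_nonneg (hw v).le (Finset.sum_nonneg fun u _ => (hw u).le)
  have h3 : (∑ v ∈ S, w v) ^ 2 ≤ (2 * ∑ v ∈ S, w v * P v) * digraphIndepNum D :=
    hcs.trans (mul_le_mul hQP (hts.trans hα)
      (Finset.sum_nonneg fun v hv => (div_pos (hw v) (hQpos v hv)).le) (by positivity))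
  have h4 : (2 * ∑ v ∈ S, w v * P v) * digraphIndepNum D < (∑ v ∈ S, w v) ^ 2 := by
    calc (2 * ∑ v ∈ S, w v * P v) * digraphIndepNum D
        = ∑ v ∈ S, w v * (2 * digraphIndepNum D * P v) := by
          rw [Finset.mul_sum, Finset.sum_mul]
          exact Finset.sum_congr rfl fun v _ => by ring
      _ < ∑ v ∈ S, w v * ∑ u ∈ S, w u :=
          Finset.sum_lt_sum_of_nonempty hS fun v hv =>
            mul_lt_mul_of_pos_left (hcon v hv) (hw v)
      _ = (∑ v ∈ S, w v) ^ 2 := by rw [← Finset.sum_mul, sq]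
  exact absurd h3 (not_le.2 h4)

theorem one_le_digraphIndepNum {V : Type*} [Finite V] [Nonempty V] (D : Digraph V) :
    1 ≤ digraphIndepNum D := by
  have h : D.toSimpleGraphInclusive.IsIndepSet
      ((({Classical.arbitrary V} : Finset V)) : Set V) := by simp
  exact h.card_le_indepNum

-- Peel off a vertex receiving at least a fraction `1 / (2 α)` of the current mass `W`. Its term is
-- at most `2 α w v / W`, and `w v / W = 1 - W' / W ≤ log W - log W'`, where `W'` is the mass left.
-- These telescope; the last vertex accounts for the 1 and `ε` bounds its weight from below.
open scoped Classical in
theorem sum_div_sum_filter_le {V : Type*} [Finite V] (D : Digraph V)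
    {w : V → ℝ} {ε : ℝ} (hε : 0 < ε) (hw : ∀ v, ε ≤ w v) (hD : ∀ v, D.Adj v v) {S : Finset V}
    (hS : S.Nonempty) :
    ∑ v ∈ S, w v / ∑ u ∈ S with D.Adj u v, w u ≤
      2 * digraphIndepNum D * (1 + Real.log ((∑ v ∈ S, w v) / ε)) := by
  have hwp : ∀ v, 0 < w v := fun v => hε.trans_le (hw v)
  have : Nonempty V := hS.to_type
  have hα : (1 : ℝ) ≤ digraphIndepNum D := by exact_mod_cast one_le_digraphIndepNum D
  induction S using Finset.strongInduction with
  | H S ih =>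
    obtain ⟨v, hv, hle⟩ := exists_sum_le_indepNum_mul D hwp hD hS
    have hPpos : ∀ (S : Finset V), ∀ u ∈ S, 0 < ∑ x ∈ S with D.Adj x u, w x := fun S u hu =>
      Finset.sum_pos (fun x _ => hwp x) ⟨u, by simp [hu, hD]⟩
    have hWpos : 0 < ∑ u ∈ S, w u := Finset.sum_pos (fun x _ => hwp x) hS
    have hv1 : w v / ∑ u ∈ S with D.Adj u v, w u ≤
        2 * digraphIndepNum D * (w v / ∑ u ∈ S, w u) := by
      rw [mul_div_assoc', div_le_div_iff₀ (hPpos S v hv) hWpos]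
      nlinarith [mul_le_mul_of_nonneg_left hle (hwp v).le]
    rw [← Finset.add_sum_erase S _ hv]
    have hsplit : ∑ u ∈ S, w u = w v + ∑ u ∈ S.erase v, w u := (Finset.add_sum_erase S _ hv).symm
    obtain he | hne := (S.erase v).eq_empty_or_nonempty
    · rw [he] at hsplit ⊢
      simp only [Finset.sum_empty, add_zero] at hsplit ⊢
      rw [hsplit, div_self (hwp v).ne'] at hv1
      refine hv1.trans ?_
      rw [hsplit]
      have : 0 ≤ Real.log (w v / ε) := Real.log_nonneg (by rw [one_le_div hε]; exact hw v)
      nlinarith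
    · have hW' : 0 < ∑ u ∈ S.erase v, w u := Finset.sum_pos (fun x _ => hwp x) hne
      have hrest : ∑ x ∈ S.erase v, w x / ∑ u ∈ S with D.Adj u x, w u ≤
          2 * digraphIndepNum D * (1 + Real.log ((∑ v ∈ S.erase v, w v) / ε)) := by
        refine le_trans (Finset.sum_le_sum fun x hx => ?_)
          (ih (S.erase v) (Finset.erase_ssubset hv) hne)
        refine div_le_div_of_nonneg_left (hwp x).le (hPpos _ x hx) ?_
        exact Finset.sum_le_sum_of_subset_of_nonneg
          (Finset.filter_subset_filter _ (Finset.erase_subset _ _)) fun y _ _ => (hwp y).le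
      have hlog : w v / ∑ u ∈ S, w u ≤
          Real.log ((∑ u ∈ S, w u) / ε) - Real.log ((∑ u ∈ S.erase v, w u) / ε) := by
        rw [Real.log_div hWpos.ne' hε.ne', Real.log_div hW'.ne' hε.ne']
        have h := Real.one_sub_inv_le_log_of_pos (div_pos hWpos hW')
        rw [Real.log_div hWpos.ne' hW'.ne', inv_div] at h
        have h' : w v / ∑ u ∈ S, w u = 1 - (∑ u ∈ S.erase v, w u) / ∑ u ∈ S, w u := by
          field_simp
          linarith
        linarith
      have := mul_le_mul_of_nonneg_left hlog (by positivity : (0 : ℝ) ≤ 2 * digraphIndepNum D)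
      linarith

/-! ### Observation probabilities -/

theorem prod_one_sub_le {ι : Type*} (s : Finset ι) {p : ι → ℝ} (hp : ∀ i, 0 ≤ p i)
    (hp1 : ∀ i, p i ≤ 1) : ∏ i ∈ s, (1 - p i) ≤ 1 / (1 + ∑ i ∈ s, p i) := by
  have hS : 0 ≤ ∑ i ∈ s, p i := Finset.sum_nonneg fun i _ => hp i
  calc ∏ i ∈ s, (1 - p i) ≤ ∏ i ∈ s, Real.exp (-p i) :=
        Finset.prod_le_prod (fun i _ => sub_nonneg.2 (hp1 i))
          fun i _ => Real.one_sub_le_exp_neg _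
    _ = (Real.exp (∑ i ∈ s, p i))⁻¹ := by
        rw [← Real.exp_sum, Finset.sum_neg_distrib, Real.exp_neg]
    _ ≤ 1 / (1 + ∑ i ∈ s, p i) := by
        rw [one_div]
        refine inv_anti₀ (by positivity) ?_
        linarith [Real.add_one_le_exp (∑ i ∈ s, p i)]

open scoped Classical in
theorem le_observeProb {V A : Type*} [Fintype V] (D : Digraph V) (hD : ∀ v, D.Adj v v)
    {p : V → A → ℝ} (hp : ∀ v i, 0 ≤ p v i) (hp1 : ∀ v i, p v i ≤ 1) (v : V) (i : A) :
    p v i ≤ observeProb D p v i := by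
  have hv : v ∈ inNeighbors D v := by simp [inNeighbors, hD]
  unfold observeProb
  rw [← Finset.mul_prod_erase _ _ hv]
  have h1 : ∏ x ∈ (inNeighbors D v).erase v, (1 - p x i) ≤ 1 :=
    Finset.prod_le_one (fun x _ => sub_nonneg.2 (hp1 x i)) fun x _ => by linarith [hp x i]
  nlinarith [hp1 v i]

/-- With `P` the in-neighbourhood mass, `q ≥ P / (1 + P)`. This replaces the product in `q` by a sum
to which the graph bound applies, at the cost of an extra `p`. -/
theorem div_observeProb_le {V A : Type*} [Fintype V] (D : Digraph V) (hD : ∀ v, D.Adj v v)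
    {p : V → A → ℝ} (hp : ∀ v i, 0 < p v i) (hp1 : ∀ v i, p v i ≤ 1) (v : V) (i : A) :
    p v i / observeProb D p v i ≤ p v i + p v i / ∑ u ∈ inNeighbors D v, p u i := by
  have hv : v ∈ inNeighbors D v := by simp [inNeighbors, hD]
  have hq := (hp v i).trans_le (le_observeProb D hD (fun v i => (hp v i).le) hp1 v i)
  have hP : 0 < ∑ u ∈ inNeighbors D v, p u i := Finset.sum_pos (fun u _ => hp u i) ⟨v, hv⟩
  have h := prod_one_sub_le (inNeighbors D v) (fun u => (hp u i).le) (fun u => hp1 u i)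
  have hq' : (∑ u ∈ inNeighbors D v, p u i) / (1 + ∑ u ∈ inNeighbors D v, p u i) ≤
      observeProb D p v i := by
    unfold observeProb
    have : (∑ u ∈ inNeighbors D v, p u i) / (1 + ∑ u ∈ inNeighbors D v, p u i) =
        1 - 1 / (1 + ∑ u ∈ inNeighbors D v, p u i) := by field_simp; ring
    linarith
  calc p v i / observeProb D p v i ≤ p v i /
        ((∑ u ∈ inNeighbors D v, p u i) / (1 + ∑ u ∈ inNeighbors D v, p u i)) :=
        div_le_div_of_nonneg_left (hp v i).le (by positivity) hq'
    _ = _ := by field_simp; ring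

theorem sum_div_observeProb_le {V A : Type*} [Fintype V] [Nonempty V] (D : Digraph V)
    (hD : ∀ v, D.Adj v v) {p : V → A → ℝ} {ε : ℝ} (hε : 0 < ε) (hp : ∀ v i, ε ≤ p v i)
    (hp1 : ∀ v i, p v i ≤ 1) (i : A) :
    ∑ v, p v i / observeProb D p v i ≤
      ∑ v, p v i + 2 * digraphIndepNum D * (1 + Real.log (Fintype.card V / ε)) := by
  have hpos : ∀ v i, 0 < p v i := fun v i => hε.trans_le (hp v i)
  refine (Finset.sum_le_sum fun v _ => div_observeProb_le D hD hpos hp1 v i).trans ?_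
  rw [Finset.sum_add_distrib]
  gcongr
  refine (sum_div_sum_filter_le D hε (fun v => hp v i) hD Finset.univ_nonempty).trans ?_
  have h0 : 0 < ∑ v, p v i := Finset.sum_pos (fun v _ => hpos v i) Finset.univ_nonempty
  gcongr
  calc ∑ v, p v i ≤ ∑ _v : V, (1 : ℝ) := Finset.sum_le_sum fun v _ => hp1 v i
    _ = Fintype.card V := by simp

/-! ### A single truncated exponential-weights update -/

section ActionDist

variable {A : Type*} [Fintype A] [Nonempty A] {δ η ρ : ℝ} {w p L : A → ℝ}

theorem sum_truncated_le (hδ : 0 < δ) (hw : ∀ i, 0 < w i) : ∑ i, truncated δ w i ≤ 1 + δ := by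
  have hW : 0 < ∑ j, w j := Finset.sum_pos (fun i _ => hw i) Finset.univ_nonempty
  have hK : (0 : ℝ) < Fintype.card A := by exact_mod_cast Fintype.card_pos
  calc ∑ i, truncated δ w i ≤ ∑ i, (w i / ∑ j, w j + δ / Fintype.card A) :=
        Finset.sum_le_sum fun i _ => max_le_add_of_nonneg (div_pos (hw i) hW).le
          (div_pos hδ hK).le
    _ = 1 + δ := by
        rw [Finset.sum_add_distrib, ← Finset.sum_div, div_self hW.ne', Finset.sum_const,
          Finset.card_univ, nsmul_eq_mul]
        field_simp

theorem one_le_sum_truncated (hw : ∀ i, 0 < w i) : 1 ≤ ∑ i, truncated δ w i := by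
  have hW : 0 < ∑ j, w j := Finset.sum_pos (fun i _ => hw i) Finset.univ_nonempty
  calc 1 = ∑ i, w i / ∑ j, w j := by rw [← Finset.sum_div, div_self hW.ne']
    _ ≤ _ := Finset.sum_le_sum fun i _ => le_max_left _ _

theorem div_sum_div_le_actionDist (hδ : 0 < δ) (hw : ∀ i, 0 < w i) (i : A) :
    w i / (∑ j, w j) / (1 + δ) ≤ actionDist δ w i :=
  div_le_div₀ (truncated_pos hδ w i).le (le_max_left _ _)
    (zero_lt_one.trans_le (one_le_sum_truncated hw)) (sum_truncated_le hδ hw)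

theorem div_card_div_le_actionDist (hδ : 0 < δ) (hw : ∀ i, 0 < w i) (i : A) :
    δ / Fintype.card A / (1 + δ) ≤ actionDist δ w i :=
  div_le_div₀ (truncated_pos hδ w i).le (le_max_right _ _)
    (zero_lt_one.trans_le (one_le_sum_truncated hw)) (sum_truncated_le hδ hw)

theorem actionDist_le_max (hδ : 0 < δ) (hw : ∀ i, 0 < w i) (i : A) :
    actionDist δ w i ≤ max (w i / ∑ j, w j) (δ / Fintype.card A) :=
  div_le_self (truncated_pos hδ w i).le (one_le_sum_truncated hw)

-- Since `(1 + x) (1 - x + x ^ 2) = 1 + x ^ 3`. No upper bound on `x` is needed, so large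
-- importance-weighted losses are harmless.
theorem exp_neg_le_one_sub_add_sq {x : ℝ} (hx : 0 ≤ x) : Real.exp (-x) ≤ 1 - x + x ^ 2 := by
  rw [Real.exp_neg, inv_le_iff_one_le_mul₀ (Real.exp_pos x)]
  have h1 := Real.add_one_le_exp x
  have h2 : 0 ≤ 1 - x + x ^ 2 := by nlinarith [sq_nonneg (x - 1)]
  nlinarith [mul_le_mul_of_nonneg_left h1 h2, pow_nonneg hx 3]

omit [Nonempty A] in
theorem one_sub_le_sum_mul_exp (hp : ∀ i, 0 < p i) (hp1 : ∑ i, p i = 1) :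
    1 - η * ∑ i, p i * L i ≤ ∑ i, p i * Real.exp (-η * L i) := by
  calc 1 - η * ∑ i, p i * L i = ∑ i, p i * (1 - η * L i) := by
        simp_rw [mul_sub, mul_one, Finset.sum_sub_distrib, hp1, Finset.mul_sum]
        congr 1
        exact Finset.sum_congr rfl fun i _ => by ring
    _ ≤ _ := by
        refine Finset.sum_le_sum fun i _ => mul_le_mul_of_nonneg_left ?_ (hp i).le
        rw [neg_mul]
        exact Real.one_sub_le_exp_neg _

/-- The regret inequality of a single exponential-weights update. -/
theorem sum_mul_le_log_actionDist_sub (hδ : 0 < δ) (hη : 0 < η) (hp : ∀ i, 0 < p i)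
    (hp1 : ∑ i, p i = 1) (hL : ∀ i, 0 ≤ L i) (k : A) :
    η * ∑ i, p i * L i - η ^ 2 * ∑ i, p i * L i ^ 2 ≤
      Real.log (actionDist δ (fun i => p i * Real.exp (-η * L i)) k) - Real.log (p k) +
        η * L k + δ := by
  set w : A → ℝ := fun i => p i * Real.exp (-η * L i) with hw
  have hwp : ∀ i, 0 < w i := fun i => mul_pos (hp i) (Real.exp_pos _)
  have hW : 0 < ∑ j, w j := Finset.sum_pos (fun i _ => hwp i) Finset.univ_nonempty
  have hWle : ∑ j, w j ≤ 1 - η * ∑ i, p i * L i + η ^ 2 * ∑ i, p i * L i ^ 2 := by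
    calc ∑ j, w j ≤ ∑ i, p i * (1 - η * L i + (η * L i) ^ 2) := by
          refine Finset.sum_le_sum fun i _ => mul_le_mul_of_nonneg_left ?_ (hp i).le
          rw [neg_mul]
          exact exp_neg_le_one_sub_add_sq (mul_nonneg hη.le (hL i))
      _ = _ := by
          simp only [mul_add, mul_sub, mul_one, Finset.sum_add_distrib, Finset.sum_sub_distrib,
            hp1, Finset.mul_sum]
          congr 1
          · congr 1
            exact Finset.sum_congr rfl fun i _ => by ring
          · exact Finset.sum_congr rfl fun i _ => by ring
  -- Truncation divides the normalized weight by at most `1 + δ`, whence the error `log (1 + δ) ≤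
  -- δ`.
  have h1 := Real.log_le_log (div_pos (div_pos (hwp k) hW) (by linarith))
    (div_sum_div_le_actionDist hδ hwp k)
  rw [Real.log_div (div_pos (hwp k) hW).ne' (by linarith), Real.log_div (hwp k).ne' hW.ne',
    show Real.log (w k) = Real.log (p k) + -η * L k by
      rw [hw, Real.log_mul (hp k).ne' (Real.exp_pos _).ne', Real.log_exp]] at h1
  have h2 := Real.log_le_sub_one_of_pos hW
  have h3 := Real.log_le_sub_one_of_pos (by linarith : 0 < 1 + δ)
  linarith

theorem mul_le_actionDist (hδ : 0 < δ) (hη : 0 < η) (hp : ∀ i, 0 < p i)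
    (hp1 : ∑ i, p i = 1) (hL : ∀ i, 0 ≤ L i) (i : A) :
    p i * (1 - δ - η * L i) ≤ actionDist δ (fun i => p i * Real.exp (-η * L i)) i := by
  set w : A → ℝ := fun i => p i * Real.exp (-η * L i) with hw
  have hwp : ∀ i, 0 < w i := fun i => mul_pos (hp i) (Real.exp_pos _)
  have hW : 0 < ∑ j, w j := Finset.sum_pos (fun i _ => hwp i) Finset.univ_nonempty
  have hW1 : ∑ j, w j ≤ 1 := by
    rw [← hp1]
    refine Finset.sum_le_sum fun i _ => mul_le_of_le_one_right (hp i).le ?_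
    rw [Real.exp_le_one_iff]
    nlinarith [mul_nonneg hη.le (hL i)]
  have h1 := div_sum_div_le_actionDist hδ hwp i
  have h2 : w i / (1 + δ) ≤ w i / (∑ j, w j) / (1 + δ) := by
    gcongr
    exact le_div_self (hwp i).le hW hW1
  refine le_trans ?_ (h2.trans h1)
  rw [le_div_iff₀ (by linarith), hw, mul_assoc]
  refine mul_le_mul_of_nonneg_left ?_ (hp i).le
  have := Real.one_sub_le_exp_neg (η * L i)
  rw [neg_mul]
  nlinarith [mul_nonneg (mul_nonneg hη.le (hL i)) hδ.le, sq_nonneg δ]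

/-- Growth has two sources. Renormalization divides by a total weight that is at least `1 - ρ`;
truncation raises to `δ / K`, which the lower bound on `p` already matches up to `1 + δ`, and `(1 -
ρ) (1 + δ) ≤ 1`. -/
theorem mul_actionDist_le (hδ : 0 < δ) (hp : ∀ i, 0 < p i)
    (hp1 : ∑ i, p i = 1) (hpδ : ∀ i, δ / Fintype.card A / (1 + δ) ≤ p i)
    (hρ1 : ρ ≤ 1) (hδρ : δ ≤ ρ) (hLρ : η * ∑ i, p i * L i ≤ ρ) (i : A) (hη : 0 < η)
    (hL : ∀ i, 0 ≤ L i) :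
    (1 - ρ) * actionDist δ (fun i => p i * Real.exp (-η * L i)) i ≤ p i := by
  set w : A → ℝ := fun i => p i * Real.exp (-η * L i) with hw
  have hwp : ∀ i, 0 < w i := fun i => mul_pos (hp i) (Real.exp_pos _)
  have hW : 0 < ∑ j, w j := Finset.sum_pos (fun i _ => hwp i) Finset.univ_nonempty
  have hW1 : 1 - ρ ≤ ∑ j, w j := by linarith [one_sub_le_sum_mul_exp (η := η) (L := L) hp hp1]
  have hwi : w i ≤ p i := by
    refine mul_le_of_le_one_right (hp i).le ?_
    rw [Real.exp_le_one_iff]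
    nlinarith [mul_nonneg hη.le (hL i)]
  refine (mul_le_mul_of_nonneg_left (actionDist_le_max hδ hwp i) (by linarith)).trans ?_
  rw [mul_max_of_nonneg _ _ (by linarith)]
  refine max_le ?_ ((le_div_iff₀ (by linarith)).2 ?_ |>.trans (hpδ i))
  · rw [mul_div_assoc', div_le_iff₀ hW, mul_comm]
    exact mul_le_mul hwi hW1 (by linarith) (hp i).le
  · have hK : (0 : ℝ) < δ / Fintype.card A := div_pos hδ (by exact_mod_cast Fintype.card_pos)
    nlinarith [sq_nonneg δ, mul_nonneg (sub_nonneg.2 hδρ) hδ.le]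

end ActionDist

/-! ### Pathwise estimates along a fixed sequence of actions -/

section Path

variable {V A : Type*} [Fintype V] [Fintype A] [Nonempty A] {D : Digraph V} {d : V → ℕ}
  {η δ ρ : ℝ} {ℓ : ℕ → A → ℝ} {I : ℕ → V → A}

theorem weight_pos (hδ : 0 < δ) (t : ℕ) (v : V) (i : A) : 0 < weight D d η δ ℓ I t v i := by
  cases t with
  | zero => rw [weight_zero]; exact one_pos
  | succ t =>
    rw [weight_succ]
    exact mul_pos (prob_pos D d η hδ ℓ I t v i) (Real.exp_pos _)

omit [Nonempty A] in
theorem prob_succ (t : ℕ) (v : V) :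
    prob D d η δ ℓ I (t + 1) v = actionDist δ
      (fun i => prob D d η δ ℓ I t v i * Real.exp (-η * lossEst D d η δ ℓ I t v i)) := by
  funext i
  rw [prob]
  congr 1
  funext j
  exact weight_succ D d η δ ℓ I t v j

theorem prob_zero (hδ : 0 < δ) (v : V) (i : A) :
    prob D d η δ ℓ I 0 v i = 1 / Fintype.card A := by
  have h : weight D d η δ ℓ I 0 v = fun _ => 1 := funext fun i => weight_zero D d η δ ℓ I v i
  have hc := truncated_pos hδ (fun _ : A => (1 : ℝ)) i
  have hc' : ∀ j, truncated δ (fun _ : A => (1 : ℝ)) j = truncated δ (fun _ : A => (1 : ℝ)) i :=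
    fun _ => rfl
  rw [prob, h, actionDist, Finset.sum_congr rfl fun j _ => hc' j, Finset.sum_const,
    Finset.card_univ, nsmul_eq_mul]
  have : (Fintype.card A : ℝ) ≠ 0 := by exact_mod_cast Fintype.card_ne_zero
  field_simp

theorem prob_le_one (hδ : 0 < δ) (t : ℕ) (v : V) (i : A) : prob D d η δ ℓ I t v i ≤ 1 := by
  rw [← sum_prob D d η hδ ℓ I t v]
  exact Finset.single_le_sum (fun j _ => (prob_pos D d η hδ ℓ I t v j).le) (Finset.mem_univ i)

theorem le_prob (hδ : 0 < δ) (t : ℕ) (v : V) (i : A) :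
    δ / Fintype.card A / (1 + δ) ≤ prob D d η δ ℓ I t v i :=
  div_card_div_le_actionDist hδ (fun j => weight_pos hδ t v j) i

theorem prob_le_observeProb (hD : ∀ v, D.Adj v v) (hδ : 0 < δ) (t : ℕ) (v : V) (i : A) :
    prob D d η δ ℓ I t v i ≤ observeProb D (prob D d η δ ℓ I t) v i :=
  le_observeProb D hD (fun v i => (prob_pos D d η hδ ℓ I t v i).le)
    (fun v i => prob_le_one hδ t v i) v i

theorem observeProb_pos (hD : ∀ v, D.Adj v v) (hδ : 0 < δ) (t : ℕ) (v : V) (i : A) :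
    0 < observeProb D (prob D d η δ ℓ I t) v i :=
  (prob_pos D d η hδ ℓ I t v i).trans_le (prob_le_observeProb hD hδ t v i)

omit [Fintype A] [Nonempty A] in
theorem observed_nonneg (x : V → A) (v : V) (i : A) : 0 ≤ observed D x v i := by
  unfold observed; split_ifs <;> simp

omit [Fintype A] [Nonempty A] in
theorem observed_le_one (x : V → A) (v : V) (i : A) : observed D x v i ≤ 1 := by
  unfold observed; split_ifs <;> simp

omit [Fintype A] [Nonempty A] in
theorem observed_sq (x : V → A) (v : V) (i : A) : observed D x v i ^ 2 = observed D x v i := by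
  unfold observed; split_ifs <;> simp

theorem lossEst_nonneg (hD : ∀ v, D.Adj v v) (hδ : 0 < δ) (hℓ : ∀ t i, ℓ t i ∈ Set.Icc (0 : ℝ) 1)
    (t : ℕ) (v : V) (i : A) : 0 ≤ lossEst D d η δ ℓ I t v i := by
  unfold lossEst
  split_ifs
  · exact mul_nonneg (div_nonneg (hℓ _ _).1 (observeProb_pos hD hδ _ v i).le)
      (observed_nonneg _ v i)
  · exact le_rfl

/-- The cumulative regret inequality on the estimated losses. -/
theorem sum_prob_mul_lossEst_le (hD : ∀ v, D.Adj v v) (hη : 0 < η) (hδ : 0 < δ)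
    (hℓ : ∀ t i, ℓ t i ∈ Set.Icc (0 : ℝ) 1) (T : ℕ) (v : V) (k : A) :
    η * ∑ t ∈ Finset.range T, ∑ i, prob D d η δ ℓ I t v i * lossEst D d η δ ℓ I t v i -
        η ^ 2 * ∑ t ∈ Finset.range T, ∑ i,
          prob D d η δ ℓ I t v i * lossEst D d η δ ℓ I t v i ^ 2 ≤
      Real.log (Fintype.card A) +
        η * ∑ t ∈ Finset.range T, lossEst D d η δ ℓ I t v k + T * δ := by
  -- Keeping `log` of the current probability of `k` makes the one-step inequalities telescope; it
  -- is nonpositive and is dropped at the end.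
  have key : η * ∑ t ∈ Finset.range T, ∑ i,
        prob D d η δ ℓ I t v i * lossEst D d η δ ℓ I t v i -
        η ^ 2 * ∑ t ∈ Finset.range T, ∑ i,
          prob D d η δ ℓ I t v i * lossEst D d η δ ℓ I t v i ^ 2 ≤
      Real.log (prob D d η δ ℓ I T v k) + Real.log (Fintype.card A) +
        η * ∑ t ∈ Finset.range T, lossEst D d η δ ℓ I t v k + T * δ := by
    induction T with
    | zero => simp [prob_zero hδ]
    | succ T ih =>
      have h := sum_mul_le_log_actionDist_sub hδ hη (prob_pos D d η hδ ℓ I T v)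
        (sum_prob D d η hδ ℓ I T v) (lossEst_nonneg (I := I) (d := d) (η := η) hD hδ hℓ T v) k
      rw [← prob_succ] at h
      simp only [Finset.sum_range_succ]
      push_cast
      linarith
  have := Real.log_nonpos (prob_pos D d η hδ ℓ I T v k).le (prob_le_one hδ T v k)
  linarith

theorem prob_sub_prob_succ_le (hD : ∀ v, D.Adj v v) (hη : 0 < η) (hδ : 0 < δ)
    (hℓ : ∀ t i, ℓ t i ∈ Set.Icc (0 : ℝ) 1) (t : ℕ) (v : V) (i : A) :
    prob D d η δ ℓ I t v i - prob D d η δ ℓ I (t + 1) v i ≤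
      prob D d η δ ℓ I t v i * δ +
        η * (prob D d η δ ℓ I t v i * lossEst D d η δ ℓ I t v i) := by
  have h := mul_le_actionDist hδ hη (prob_pos D d η hδ ℓ I t v)
    (sum_prob D d η hδ ℓ I t v) (lossEst_nonneg (I := I) (d := d) (η := η) hD hδ hℓ t v) i
  rw [← prob_succ] at h
  linarith

/-- The drift of the loss incurred over `n` rounds. -/
theorem sum_prob_mul_le_add_drift (hD : ∀ v, D.Adj v v) (hη : 0 < η) (hδ : 0 < δ)
    (hℓ : ∀ t i, ℓ t i ∈ Set.Icc (0 : ℝ) 1) (s n : ℕ) (v : V) :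
    ∑ i, prob D d η δ ℓ I s v i * ℓ s i ≤
      ∑ i, prob D d η δ ℓ I (s + n) v i * ℓ s i + ∑ m ∈ Finset.range n,
        (δ + η * ∑ i, prob D d η δ ℓ I (s + m) v i * lossEst D d η δ ℓ I (s + m) v i) := by
  induction n with
  | zero => simp
  | succ n ih =>
    rw [Finset.sum_range_succ]
    refine ih.trans ?_
    have h : ∑ i, prob D d η δ ℓ I (s + n) v i * ℓ s i -
        ∑ i, prob D d η δ ℓ I (s + n + 1) v i * ℓ s i ≤
        δ + η * ∑ i, prob D d η δ ℓ I (s + n) v i * lossEst D d η δ ℓ I (s + n) v i := by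
      rw [← Finset.sum_sub_distrib]
      calc _ ≤ ∑ i, (prob D d η δ ℓ I (s + n) v i * δ + η *
            (prob D d η δ ℓ I (s + n) v i * lossEst D d η δ ℓ I (s + n) v i)) := by
            refine Finset.sum_le_sum fun i _ => ?_
            rw [← sub_mul]
            have h1 := prob_sub_prob_succ_le (I := I) (d := d) hD hη hδ hℓ (s + n) v i
            have h2 := prob_pos D d η hδ ℓ I (s + n) v i
            have h3 := lossEst_nonneg (I := I) (d := d) (η := η) hD hδ hℓ (s + n) v i
            refine (mul_le_mul_of_nonneg_right h1 (hℓ s i).1).trans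
              (mul_le_of_le_one_right (by positivity) (hℓ s i).2)
        _ = _ := by
            rw [Finset.sum_add_distrib, ← Finset.sum_mul, sum_prob D d η hδ, one_mul,
              Finset.mul_sum]
    rw [← add_assoc s n 1]
    linarith

omit [Nonempty A] in
theorem pow_mul_prob_add_le {s n : ℕ} (hρ1 : ρ ≤ 1) {v : V} {i : A}
    (h : ∀ t < s + n, (1 - ρ) * prob D d η δ ℓ I (t + 1) v i ≤ prob D d η δ ℓ I t v i) :
    (1 - ρ) ^ n * prob D d η δ ℓ I (s + n) v i ≤ prob D d η δ ℓ I s v i := by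
  induction n with
  | zero => simp
  | succ n ih =>
    refine le_trans ?_ (ih fun t ht => h t (by omega))
    rw [pow_succ, mul_assoc]
    exact mul_le_mul_of_nonneg_left (h (s + n) (by omega)) (pow_nonneg (by linarith) n)

theorem prob_add_le_two_mul_of_forall {s n M : ℕ} (hδ : 0 < δ) (hρ0 : 0 ≤ ρ) (hρ1 : ρ ≤ 1)
    (hM : 2 * M * ρ ≤ 1) (hn : n ≤ M) {v : V} {i : A}
    (h : ∀ t < s + n, (1 - ρ) * prob D d η δ ℓ I (t + 1) v i ≤ prob D d η δ ℓ I t v i) :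
    prob D d η δ ℓ I (s + n) v i ≤ 2 * prob D d η δ ℓ I s v i := by
  have h1 := pow_mul_prob_add_le hρ1 h
  have h2 := one_add_mul_le_pow (by linarith : -2 ≤ -ρ) n
  have h3 : (n : ℝ) * ρ ≤ M * ρ := by gcongr
  -- Bernoulli's inequality with `n ρ ≤ M ρ ≤ 1 / 2`.
  have h4 : 1 / 2 ≤ (1 - ρ) ^ n := by
    rw [sub_eq_add_neg]; linarith
  have := mul_le_mul_of_nonneg_right h4 (prob_pos D d η hδ ℓ I (s + n) v i).le
  linarith

/-- One-step stability of the action probabilities. -/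
theorem mul_prob_succ_le (hD : ∀ v, D.Adj v v) (hη : 0 < η) (hδ : 0 < δ)
    (hℓ : ∀ t i, ℓ t i ∈ Set.Icc (0 : ℝ) 1) {M : ℕ} (hρ1 : ρ ≤ 1)
    (hM : 2 * M * ρ ≤ 1) (hd : ∀ v, d v ≤ M) (hδρ : δ ≤ ρ)
    (hηρ : η * (2 * Fintype.card A) ≤ ρ) (t : ℕ) (v : V) (i : A) :
    (1 - ρ) * prob D d η δ ℓ I (t + 1) v i ≤ prob D d η δ ℓ I t v i := by
  -- Stability before `t` yields doubling over the delay, so each `p * L` at `t` is at most `2 p /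
  -- q` at round `t - d v`, hence at most 2. The normalizer then loses at most `2 K η ≤ ρ`, which is
  -- stability at `t`. All actions enter the normalizer, hence the generalization over `i`.
  induction t using Nat.strong_induction_on generalizing i with
  | _ t ih =>
    rw [prob_succ]
    refine mul_actionDist_le hδ (prob_pos D d η hδ ℓ I t v) (sum_prob D d η hδ ℓ I t v)
      (le_prob hδ t v) hρ1 hδρ (le_trans (mul_le_mul_of_nonneg_left ?_ hη.le) hηρ) i hη
      (lossEst_nonneg hD hδ hℓ t v)
    calc ∑ j, prob D d η δ ℓ I t v j * lossEst D d η δ ℓ I t v j ≤ ∑ _j : A, (2 : ℝ) := by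
          refine Finset.sum_le_sum fun j _ => ?_
          unfold lossEst
          split_ifs with hdt
          · have h1 := prob_add_le_two_mul_of_forall (D := D) (d := d) (η := η) (ℓ := ℓ) (I := I)
              (s := t - d v) hδ (hδ.le.trans hδρ)
              hρ1 hM (hd v) (i := j) fun r hr => ih r (by omega) j
            rw [Nat.sub_add_cancel hdt] at h1
            have h2 := prob_le_observeProb (d := d) (η := η) (ℓ := ℓ) (I := I) hD hδ (t - d v) v j
            have h3 := observeProb_pos (d := d) (η := η) (ℓ := ℓ) (I := I) hD hδ (t - d v) v j
            have h4 : ℓ (t - d v) j / observeProb D (prob D d η δ ℓ I (t - d v)) v j *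
                observed D (I (t - d v)) v j ≤
                1 / observeProb D (prob D d η δ ℓ I (t - d v)) v j := by
              refine (mul_le_of_le_one_right (div_nonneg (hℓ _ _).1 h3.le)
                (observed_le_one _ v j)).trans ?_
              gcongr
              exact (hℓ _ _).2
            refine (mul_le_mul_of_nonneg_left h4 (prob_pos D d η hδ ℓ I t v j).le).trans ?_
            rw [mul_one_div, div_le_iff₀ h3]
            linarith
          · simp
      _ = 2 * Fintype.card A := by simp [mul_comm]

theorem prob_add_le_two_mul (hD : ∀ v, D.Adj v v) (hη : 0 < η) (hδ : 0 < δ)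
    (hℓ : ∀ t i, ℓ t i ∈ Set.Icc (0 : ℝ) 1) {M : ℕ} (hρ1 : ρ ≤ 1)
    (hM : 2 * M * ρ ≤ 1) (hd : ∀ v, d v ≤ M) (hδρ : δ ≤ ρ)
    (hηρ : η * (2 * Fintype.card A) ≤ ρ) (s : ℕ) (v : V) (i : A) :
    prob D d η δ ℓ I (s + d v) v i ≤ 2 * prob D d η δ ℓ I s v i :=
  prob_add_le_two_mul_of_forall hδ (hδ.le.trans hδρ) hρ1 hM (hd v) fun t _ =>
    mul_prob_succ_le hD hη hδ hℓ hρ1 hM hd hδρ hηρ t v i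

end Path

/-! ### Expectations and conditioning on the past -/

section Expectation

variable {V A : Type*} [Fintype V] [DecidableEq V] [Fintype A] [Nonempty A] {D : Digraph V}
  {d : V → ℕ} {η δ : ℝ} {ℓ : ℕ → A → ℝ} {T : ℕ}

/-- Expectation of a function of the infinite sequence of actions, the actions of the rounds `≥ T`
being fixed. -/
noncomputable def pathExpect (D : Digraph V) (d : V → ℕ) (η δ : ℝ) (ℓ : ℕ → A → ℝ) (T : ℕ)
    (F : (ℕ → V → A) → ℝ) : ℝ :=
  expect D d η δ ℓ T fun a => F (extend a)

theorem pathExpect_add (F G : (ℕ → V → A) → ℝ) :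
    pathExpect D d η δ ℓ T (fun I => F I + G I) =
      pathExpect D d η δ ℓ T F + pathExpect D d η δ ℓ T G := by
  simp only [pathExpect, expect, mul_add, Finset.sum_add_distrib]

theorem pathExpect_mul_left (c : ℝ) (F : (ℕ → V → A) → ℝ) :
    pathExpect D d η δ ℓ T (fun I => c * F I) = c * pathExpect D d η δ ℓ T F := by
  simp only [pathExpect, expect, Finset.mul_sum]
  exact Finset.sum_congr rfl fun a _ => by ring

theorem pathExpect_sub (F G : (ℕ → V → A) → ℝ) :
    pathExpect D d η δ ℓ T (fun I => F I - G I) =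
      pathExpect D d η δ ℓ T F - pathExpect D d η δ ℓ T G := by
  simp only [pathExpect, expect, mul_sub, Finset.sum_sub_distrib]

theorem pathExpect_sum {ι : Type*} (s : Finset ι) (F : ι → (ℕ → V → A) → ℝ) :
    pathExpect D d η δ ℓ T (fun I => ∑ i ∈ s, F i I) = ∑ i ∈ s, pathExpect D d η δ ℓ T (F i) := by
  simp only [pathExpect, expect, Finset.mul_sum]
  exact Finset.sum_comm

theorem pathExpect_const (hδ : 0 < δ) (c : ℝ) :
    pathExpect D d η δ ℓ T (fun _ : ℕ → V → A => c) = c := by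
  rw [pathExpect, expect, ← Finset.sum_mul, sum_trajProb D d η hδ, one_mul]

theorem pathExpect_mono (hδ : 0 < δ) {F G : (ℕ → V → A) → ℝ} (h : ∀ I, F I ≤ G I) :
    pathExpect D d η δ ℓ T F ≤ pathExpect D d η δ ℓ T G :=
  Finset.sum_le_sum fun a _ => mul_le_mul_of_nonneg_left (h _) (trajProb_nonneg D d η hδ ℓ T a)

omit [DecidableEq V] [Nonempty A] in
theorem dependsOn_prob (t : ℕ) :
    DependsOn (fun I : ℕ → V → A => prob D d η δ ℓ I t) (Set.Iio t) := by
  intro I J h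
  funext v i
  simp only [prob]
  rw [weight_congr D d η δ ℓ I J t h]

omit [Fintype V] [DecidableEq V] [Fintype A] in
theorem extend_snoc (a : Fin T → V → A) (x : V → A) :
    extend (Fin.snoc (α := fun _ => V → A) a x) = Function.update (extend a) T x := by
  funext t v
  rcases lt_trichotomy t T with h | rfl | h
  · simp [extend, h, Nat.lt_succ_of_lt h, Fin.snoc, h.ne]
  · simp [extend, Fin.snoc]
  · have h1 : ¬ t < T + 1 := by omega
    have h2 : ¬ t < T := by omega
    simp [extend, h.ne', h1, h2]

omit [DecidableEq V] in
theorem trajProb_snoc (a : Fin T → V → A) (x : V → A) :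
    trajProb D d η δ ℓ (T + 1) (Fin.snoc (α := fun _ => V → A) a x) =
      trajProb D d η δ ℓ T a * ∏ v, prob D d η δ ℓ (extend a) T v (x v) := by
  have hp : ∀ t ≤ T, prob D d η δ ℓ (Function.update (extend a) T x) t =
      prob D d η δ ℓ (extend a) t := fun t ht =>
    dependsOn_prob t fun s (hs : s < t) => Function.update_of_ne (by omega) _ _
  unfold trajProb
  rw [Fin.prod_univ_castSucc, extend_snoc]
  congr 1
  · refine Finset.prod_congr rfl fun t _ => Finset.prod_congr rfl fun v _ => ?_
    rw [Fin.val_castSucc, hp t t.2.le, Fin.snoc_castSucc]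
  · refine Finset.prod_congr rfl fun v _ => ?_
    rw [Fin.val_last, hp T le_rfl, Fin.snoc_last]

/-- Tower property: the last round is integrated out first, by overwriting its default action. -/
theorem pathExpect_succ (F : (ℕ → V → A) → ℝ) :
    pathExpect D d η δ ℓ (T + 1) F = pathExpect D d η δ ℓ T fun I =>
      ∑ x : V → A, (∏ v, prob D d η δ ℓ I T v (x v)) * F (Function.update I T x) := by
  simp only [pathExpect, expect]
  rw [← (Fin.snocEquiv (fun _ : Fin (T + 1) => V → A)).sum_comp, Fintype.sum_prod_type_right]
  refine Finset.sum_congr rfl fun a _ => ?_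
  rw [Finset.mul_sum]
  refine Finset.sum_congr rfl fun x _ => ?_
  have h : Fin.snocEquiv (fun _ : Fin (T + 1) => V → A) (x, a) =
      Fin.snoc (α := fun _ => V → A) a x := rfl
  rw [h, trajProb_snoc, extend_snoc, mul_assoc]

theorem sum_prod_prob (hδ : 0 < δ) (I : ℕ → V → A) (t : ℕ) :
    ∑ x : V → A, ∏ v, prob D d η δ ℓ I t v (x v) = 1 := by
  rw [← Fintype.prod_sum]
  exact Finset.prod_eq_one fun v _ => sum_prob D d η hδ ℓ I t v

theorem pathExpect_eq_of_dependsOn (hδ : 0 < δ) {F : (ℕ → V → A) → ℝ} {s : ℕ}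
    (hF : DependsOn F (Set.Iio s)) (hs : s ≤ T) :
    pathExpect D d η δ ℓ T F = pathExpect D d η δ ℓ s F := by
  induction T, hs using Nat.le_induction with
  | base => rfl
  | succ T hT ih =>
    rw [pathExpect_succ, ← ih]
    congr 1
    funext I
    have h : ∀ x, F (Function.update I T x) = F I := fun x =>
      hF fun r (hr : r < s) => Function.update_of_ne (by omega) _ _
    simp only [h]
    rw [← Finset.sum_mul, sum_prod_prob hδ, one_mul]

/-- Conditional expectation given the past of a function of the actions of round `s`. -/
theorem pathExpect_mul_apply (hδ : 0 < δ) {g : (ℕ → V → A) → ℝ} {s : ℕ}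
    (hg : DependsOn g (Set.Iio s)) (hs : s < T) (h : (V → A) → ℝ) :
    pathExpect D d η δ ℓ T (fun I => g I * h (I s)) = pathExpect D d η δ ℓ T (fun I =>
      g I * ∑ x : V → A, (∏ v, prob D d η δ ℓ I s v (x v)) * h x) := by
  have h1 : DependsOn (fun I => g I * h (I s)) (Set.Iio (s + 1)) := fun I J hIJ => by
    simp only
    rw [hg fun r (hr : r < s) => hIJ r (Nat.lt_succ_of_lt hr), hIJ s (Nat.lt_succ_self s)]
  have h2 : DependsOn (fun I => g I * ∑ x : V → A, (∏ v, prob D d η δ ℓ I s v (x v)) * h x)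
      (Set.Iio s) := fun I J hIJ => by
    have hp : prob D d η δ ℓ I s = prob D d η δ ℓ J s := dependsOn_prob s hIJ
    simp only
    rw [hg hIJ, hp]
  rw [pathExpect_eq_of_dependsOn hδ h1 hs, pathExpect_eq_of_dependsOn hδ h2 hs.le,
    pathExpect_succ]
  congr 1
  funext I
  rw [Finset.mul_sum]
  refine Finset.sum_congr rfl fun x _ => ?_
  rw [Function.update_self, hg fun r (hr : r < s) => Function.update_of_ne hr.ne _ _]
  ring

-- The complementary event, that no in-neighbour plays `i`, has an indicator that factors over
-- agents; the sum over joint actions then becomes a product of one-agent sums.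
omit [Nonempty A] in
theorem sum_prod_mul_observed {p : V → A → ℝ} (hp : ∀ v, ∑ i, p v i = 1) (v : V) (i : A) :
    ∑ x : V → A, (∏ u, p u (x u)) * observed D x v i = observeProb D p v i := by
  classical
  have h : ∀ x : V → A, (∏ u, p u (x u)) * observed D x v i = ∏ u, p u (x u) -
      ∏ u, (p u (x u) * if u ∈ inNeighbors D v ∧ x u = i then 0 else 1) := by
    intro x
    rw [Finset.prod_mul_distrib, observed]
    split_ifs with hx
    · obtain ⟨u, hu, hui⟩ := hx
      rw [Finset.prod_eq_zero (f := fun u => if u ∈ inNeighbors D v ∧ x u = i then (0 : ℝ) else 1)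
        (Finset.mem_univ u) (if_pos ⟨hu, hui⟩)]
      ring
    · rw [Finset.prod_eq_one (f := fun u => if u ∈ inNeighbors D v ∧ x u = i then (0 : ℝ) else 1)
        fun u _ => if_neg fun hu => hx ⟨u, hu.1, hu.2⟩]
      ring
  simp only [h, Finset.sum_sub_distrib]
  rw [← Fintype.prod_sum, Finset.prod_eq_one fun u _ => hp u,
    ← Fintype.prod_sum (fun u j => p u j * if u ∈ inNeighbors D v ∧ j = i then 0 else 1),
    observeProb]
  congr 1
  rw [← Finset.prod_subset (Finset.subset_univ (inNeighbors D v))]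
  · refine Finset.prod_congr rfl fun u hu => ?_
    have hsplit := Finset.add_sum_erase _ (p u) (Finset.mem_univ i)
    rw [hp u] at hsplit
    rw [← Finset.add_sum_erase _ _ (Finset.mem_univ i)]
    simp only [hu, true_and, if_true, mul_zero, zero_add]
    rw [← eq_sub_of_add_eq' hsplit]
    exact Finset.sum_congr rfl fun j hj => by rw [if_neg (Finset.ne_of_mem_erase hj), mul_one]
  · intro u _ hu
    simp [hu, hp u]

theorem pathExpect_mul_observed (hδ : 0 < δ) {g : (ℕ → V → A) → ℝ} {s : ℕ}
    (hg : DependsOn g (Set.Iio s)) (hs : s < T) (v : V) (i : A) :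
    pathExpect D d η δ ℓ T (fun I => g I * observed D (I s) v i) = pathExpect D d η δ ℓ T
      (fun I => g I * observeProb D (prob D d η δ ℓ I s) v i) := by
  rw [pathExpect_mul_apply hδ hg hs fun x => observed D x v i]
  congr 1
  funext I
  rw [sum_prod_mul_observed (sum_prob D d η hδ ℓ I s)]

theorem pathExpect_apply (hδ : 0 < δ) {s : ℕ} (hs : s < T) (v : V) (f : A → ℝ) :
    pathExpect D d η δ ℓ T (fun I => f (I s v)) =
      pathExpect D d η δ ℓ T (fun I => ∑ i, prob D d η δ ℓ I s v i * f i) := by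
  have h := pathExpect_mul_apply (D := D) (d := d) (η := η) (ℓ := ℓ) (T := T) hδ
    (g := fun _ => 1) (fun _ _ _ => rfl) hs fun x : V → A => f (x v)
  simp only [one_mul] at h
  rw [h]
  congr 1
  funext I
  have h1 : ∀ x : V → A, (∏ u, prob D d η δ ℓ I s u (x u)) * f (x v) =
      ∏ u, (prob D d η δ ℓ I s u (x u) * if u = v then f (x u) else 1) := fun x => by
    rw [Finset.prod_mul_distrib, Finset.prod_ite_eq' Finset.univ v, if_pos (Finset.mem_univ v)]
  simp only [h1]
  rw [← Fintype.prod_sum (fun u j => prob D d η δ ℓ I s u j * if u = v then f j else 1),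
    Finset.prod_eq_single v]
  · simp
  · intro u _ hu
    simp [hu, sum_prob D d η hδ ℓ I s u]
  · simp

omit [DecidableEq V] [Nonempty A] in
theorem lossEst_add (I : ℕ → V → A) (s : ℕ) (v : V) (i : A) :
    lossEst D d η δ ℓ I (s + d v) v i =
      ℓ s i / observeProb D (prob D d η δ ℓ I s) v i * observed D (I s) v i := by
  rw [lossEst, if_pos (Nat.le_add_left _ _), Nat.add_sub_cancel]

omit [DecidableEq V] [Nonempty A] in
theorem lossEst_of_lt (I : ℕ → V → A) {t : ℕ} {v : V} (h : t < d v) (i : A) :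
    lossEst D d η δ ℓ I t v i = 0 := if_neg (not_le.2 h)

omit [DecidableEq V] [Nonempty A] in
/-- The distribution of an agent only uses actions that are older than its delay. -/
theorem dependsOn_prob_sub_delay (t : ℕ) (v : V) :
    DependsOn (fun I : ℕ → V → A => prob D d η δ ℓ I t v) (Set.Iio (t - d v)) := by
  induction t with
  | zero =>
    intro I J _
    funext i
    simp only [prob]
    congr 1
    funext j
    rw [weight_zero, weight_zero]
  | succ t ih =>
    intro I J h
    have h1 : prob D d η δ ℓ I t v = prob D d η δ ℓ J t v :=
      -- Truncated subtraction covers the initial phase `t < d v`: no action is used and the set is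
      -- empty.
      ih fun r (hr : r < t - d v) => h r (by simp only [Set.mem_Iio]; omega)
    have h2 : lossEst D d η δ ℓ I t v = lossEst D d η δ ℓ J t v := by
      funext i
      unfold lossEst
      split_ifs with hd
      · have h3 : prob D d η δ ℓ I (t - d v) = prob D d η δ ℓ J (t - d v) :=
          dependsOn_prob _ fun r (hr : r < t - d v) => h r (by simp only [Set.mem_Iio]; omega)
        rw [h3, h (t - d v) (by simp only [Set.mem_Iio]; omega)]
      · rfl
    simp only [prob_succ, h1, h2]

-- This is the measurability that lets round `s` be averaged out while the distribution of `v` at `s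
-- + d v` is held fixed.
omit [DecidableEq V] [Nonempty A] in
theorem dependsOn_prob_add_delay (s : ℕ) (v : V) :
    DependsOn (fun I : ℕ → V → A => prob D d η δ ℓ I (s + d v) v) (Set.Iio s) := by
  have h := dependsOn_prob_sub_delay (D := D) (d := d) (η := η) (δ := δ) (ℓ := ℓ) (s + d v) v
  rwa [Nat.add_sub_cancel] at h

theorem pathExpect_prob_mul_lossEst (hD : ∀ v, D.Adj v v) (hδ : 0 < δ) {s : ℕ} (hs : s < T)
    (v : V) (i : A) :
    pathExpect D d η δ ℓ T
        (fun I => prob D d η δ ℓ I (s + d v) v i * lossEst D d η δ ℓ I (s + d v) v i) =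
      pathExpect D d η δ ℓ T (fun I => prob D d η δ ℓ I (s + d v) v i * ℓ s i) := by
  simp only [lossEst_add, ← mul_assoc]
  rw [pathExpect_mul_observed hδ (g := fun I => prob D d η δ ℓ I (s + d v) v i *
    (ℓ s i / observeProb D (prob D d η δ ℓ I s) v i)) _ hs]
  · congr 1
    funext I
    have := (observeProb_pos (d := d) (η := η) (ℓ := ℓ) (I := I) hD hδ s v i).ne'
    field_simp
  · intro I J h
    have h1 : prob D d η δ ℓ I s = prob D d η δ ℓ J s := dependsOn_prob s h
    have h2 : prob D d η δ ℓ I (s + d v) v = prob D d η δ ℓ J (s + d v) v :=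
      dependsOn_prob_add_delay s v h
    simp only [h1, h2]

theorem pathExpect_lossEst (hD : ∀ v, D.Adj v v) (hδ : 0 < δ) {s : ℕ} (hs : s < T)
    (v : V) (i : A) :
    pathExpect D d η δ ℓ T (fun I => lossEst D d η δ ℓ I (s + d v) v i) = ℓ s i := by
  simp only [lossEst_add]
  rw [pathExpect_mul_observed hδ (g := fun I =>
    ℓ s i / observeProb D (prob D d η δ ℓ I s) v i) _ hs]
  · refine Eq.trans ?_ (pathExpect_const (D := D) (d := d) (η := η) (ℓ := ℓ) (T := T) hδ (ℓ s i))
    congr 1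
    funext I
    have := (observeProb_pos (d := d) (η := η) (ℓ := ℓ) (I := I) hD hδ s v i).ne'
    field_simp
  · intro I J h
    have h1 : prob D d η δ ℓ I s = prob D d η δ ℓ J s := dependsOn_prob s h
    simp only [h1]

/-- The indicator is idempotent, so averaging it cancels only one of the two factors `1 / q`. -/
theorem pathExpect_prob_mul_lossEst_sq (hD : ∀ v, D.Adj v v) (hδ : 0 < δ) {s : ℕ} (hs : s < T)
    (v : V) (i : A) :
    pathExpect D d η δ ℓ T
        (fun I => prob D d η δ ℓ I (s + d v) v i * lossEst D d η δ ℓ I (s + d v) v i ^ 2) =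
      pathExpect D d η δ ℓ T (fun I => prob D d η δ ℓ I (s + d v) v i * ℓ s i ^ 2 /
        observeProb D (prob D d η δ ℓ I s) v i) := by
  simp only [lossEst_add, mul_pow, observed_sq, ← mul_assoc]
  rw [pathExpect_mul_observed hδ (g := fun I => prob D d η δ ℓ I (s + d v) v i *
    (ℓ s i / observeProb D (prob D d η δ ℓ I s) v i) ^ 2) _ hs]
  · congr 1
    funext I
    have := (observeProb_pos (d := d) (η := η) (ℓ := ℓ) (I := I) hD hδ s v i).ne'
    field_simp
  · intro I J h
    have h1 : prob D d η δ ℓ I s = prob D d η δ ℓ J s := dependsOn_prob s h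
    have h2 : prob D d η δ ℓ I (s + d v) v = prob D d η δ ℓ J (s + d v) v :=
      dependsOn_prob_add_delay s v h
    simp only [h1, h2]

end Expectation

/-! ### From estimated losses to the regret -/

section Regret

variable {V A : Type*} [Fintype V] [DecidableEq V] [Fintype A] [Nonempty A] {D : Digraph V}
  {d : V → ℕ} {η δ ρ : ℝ} {ℓ : ℕ → A → ℝ} {T : ℕ}

omit [DecidableEq V] in
theorem sum_prob_mul_le_one (hδ : 0 < δ) (hℓ : ∀ t i, ℓ t i ∈ Set.Icc (0 : ℝ) 1)
    (I : ℕ → V → A) (t s : ℕ) (v : V) : ∑ i, prob D d η δ ℓ I t v i * ℓ s i ≤ 1 := by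
  rw [← sum_prob D d η hδ ℓ I t v]
  exact Finset.sum_le_sum fun i _ =>
    mul_le_of_le_one_right (prob_pos D d η hδ ℓ I t v i).le (hℓ s i).2

theorem pathExpect_sum_prob_mul_lossEst (hD : ∀ v, D.Adj v v) (hδ : 0 < δ) {s : ℕ} (hs : s < T)
    (v : V) :
    pathExpect D d η δ ℓ T
        (fun I => ∑ i, prob D d η δ ℓ I (s + d v) v i * lossEst D d η δ ℓ I (s + d v) v i) =
      pathExpect D d η δ ℓ T (fun I => ∑ i, prob D d η δ ℓ I (s + d v) v i * ℓ s i) := by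
  rw [pathExpect_sum, pathExpect_sum]
  exact Finset.sum_congr rfl fun i _ => pathExpect_prob_mul_lossEst hD hδ hs v i

theorem pathExpect_sum_prob_mul_lossEst_le_one (hD : ∀ v, D.Adj v v) (hδ : 0 < δ)
    (hℓ : ∀ t i, ℓ t i ∈ Set.Icc (0 : ℝ) 1) {t : ℕ} (ht : t < T) (v : V) :
    pathExpect D d η δ ℓ T
        (fun I => ∑ i, prob D d η δ ℓ I t v i * lossEst D d η δ ℓ I t v i) ≤ 1 := by
  rw [← pathExpect_const (D := D) (d := d) (η := η) (ℓ := ℓ) (T := T) hδ 1]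
  rcases lt_or_ge t (d v) with h | h
  · refine pathExpect_mono hδ fun I => ?_
    simp [lossEst_of_lt I h]
  · obtain ⟨s, rfl⟩ := Nat.exists_eq_add_of_le' h
    rw [pathExpect_sum_prob_mul_lossEst hD hδ (by omega) v]
    exact pathExpect_mono hδ fun I => sum_prob_mul_le_one hδ hℓ I _ _ v

/-- Taking expectations before bounding the drift is what gives `η` per round: pathwise, the sum of
`p * L` is only controlled by the number of actions. -/
theorem pathExpect_drift_le (hD : ∀ v, D.Adj v v) (hη : 0 < η) (hδ : 0 < δ)
    (hℓ : ∀ t i, ℓ t i ∈ Set.Icc (0 : ℝ) 1) {s : ℕ} {v : V} (hs : s + d v < T) :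
    pathExpect D d η δ ℓ T (fun I => ∑ i, prob D d η δ ℓ I s v i * ℓ s i) ≤
      pathExpect D d η δ ℓ T (fun I => ∑ i,
        prob D d η δ ℓ I (s + d v) v i * lossEst D d η δ ℓ I (s + d v) v i) +
      d v * (δ + η) := by
  refine (pathExpect_mono hδ fun I =>
    sum_prob_mul_le_add_drift hD hη hδ hℓ s (d v) v).trans ?_
  rw [pathExpect_add, pathExpect_sum_prob_mul_lossEst hD hδ (by omega),
    pathExpect_sum (Finset.range (d v))]
  refine add_le_add le_rfl ?_
  refine (Finset.sum_le_sum (g := fun _ => δ + η) fun m hm => ?_).trans_eq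
    (by rw [Finset.sum_const, Finset.card_range, nsmul_eq_mul])
  have hm := Finset.mem_range.1 hm
  rw [pathExpect_add, pathExpect_mul_left, pathExpect_const hδ]
  exact add_le_add le_rfl <| mul_le_of_le_one_right hη.le
    (pathExpect_sum_prob_mul_lossEst_le_one hD hδ hℓ (by omega) v)

/-- The last `n` terms of `f` have no partner below `T` and cost 1 each; the first `n` terms of `g`
are discarded by sign. -/
theorem sum_range_le_sum_shift {f g : ℕ → ℝ} {n T : ℕ} {c : ℝ} (hn : n ≤ T) (hc : 0 ≤ c)
    (hf : ∀ s < T, f s ≤ 1) (hg : ∀ t < n, 0 ≤ g t) (h : ∀ s, s + n < T → f s ≤ g (s + n) + c) :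
    ∑ s ∈ Finset.range T, f s ≤ ∑ t ∈ Finset.range T, g t + T * c + n := by
  obtain ⟨m, rfl⟩ := Nat.exists_eq_add_of_le' hn
  have h1 : ∑ s ∈ Finset.range m, f s ≤ ∑ s ∈ Finset.range m, (g (s + n) + c) :=
    Finset.sum_le_sum fun s hs => h s (by have := Finset.mem_range.1 hs; omega)
  have h2 : ∑ x ∈ Finset.range n, f (m + x) ≤ ∑ _x ∈ Finset.range n, (1 : ℝ) :=
    Finset.sum_le_sum fun s hs => hf _ (by have := Finset.mem_range.1 hs; omega)
  have h3 : ∑ s ∈ Finset.range (m + n), g s =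
      ∑ s ∈ Finset.range n, g s + ∑ s ∈ Finset.range m, g (s + n) := by
    rw [add_comm m n, Finset.sum_range_add]
    simp only [add_comm]
  have h4 : 0 ≤ ∑ s ∈ Finset.range n, g s :=
    Finset.sum_nonneg fun s hs => hg s (Finset.mem_range.1 hs)
  rw [Finset.sum_range_add, h3]
  rw [Finset.sum_add_distrib] at h1
  simp only [Finset.sum_const, Finset.card_range, nsmul_eq_mul, mul_one] at h1 h2
  push_cast
  nlinarith [mul_nonneg (Nat.cast_nonneg (α := ℝ) n) hc]

theorem sum_range_shift_le {f g : ℕ → ℝ} {n T : ℕ} (hn : n ≤ T)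
    (hf : ∀ s < T, 0 ≤ f s) (hg : ∀ t < n, g t = 0) (h : ∀ s, s + n < T → g (s + n) ≤ f s) :
    ∑ t ∈ Finset.range T, g t ≤ ∑ s ∈ Finset.range T, f s := by
  obtain ⟨m, rfl⟩ := Nat.exists_eq_add_of_le hn
  rw [Finset.sum_range_add, Finset.sum_eq_zero fun t ht => hg t (Finset.mem_range.1 ht), zero_add]
  calc _ ≤ ∑ s ∈ Finset.range m, f s := Finset.sum_le_sum fun s hs => by
        rw [add_comm]
        exact h s (by have := Finset.mem_range.1 hs; omega)
    _ ≤ _ := Finset.sum_le_sum_of_subset_of_nonneg (Finset.range_mono (by omega))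
        fun s hs _ => hf s (Finset.mem_range.1 hs)

theorem pathExpect_nonneg (hδ : 0 < δ) {F : (ℕ → V → A) → ℝ} (h : ∀ I, 0 ≤ F I) :
    0 ≤ pathExpect D d η δ ℓ T F :=
  Finset.sum_nonneg fun a _ => mul_nonneg (trajProb_nonneg D d η hδ ℓ T a) (h _)

theorem sum_pathExpect_lossEst_le (hD : ∀ v, D.Adj v v) (hδ : 0 < δ)
    (hℓ : ∀ t i, ℓ t i ∈ Set.Icc (0 : ℝ) 1) {v : V} (hv : d v ≤ T) (k : A) :
    ∑ t ∈ Finset.range T, pathExpect D d η δ ℓ T (fun I => lossEst D d η δ ℓ I t v k) ≤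
      ∑ t ∈ Finset.range T, ℓ t k := by
  refine sum_range_shift_le hv (fun s _ => (hℓ s k).1) (fun t ht => ?_) fun s hs =>
    (pathExpect_lossEst hD hδ (by omega) v k).le
  simp only [lossEst_of_lt _ ht]
  exact pathExpect_const hδ 0

/-- Doubling moves `p` back to the round of `q`, the form needed by the graph bound. -/
theorem sum_pathExpect_lossEst_sq_le (hD : ∀ v, D.Adj v v) (hδ : 0 < δ)
    (hℓ : ∀ t i, ℓ t i ∈ Set.Icc (0 : ℝ) 1)
    (hstab : ∀ I s v i, prob D d η δ ℓ I (s + d v) v i ≤ 2 * prob D d η δ ℓ I s v i)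
    {v : V} (hv : d v ≤ T) :
    ∑ t ∈ Finset.range T, pathExpect D d η δ ℓ T
        (fun I => ∑ i, prob D d η δ ℓ I t v i * lossEst D d η δ ℓ I t v i ^ 2) ≤
      ∑ s ∈ Finset.range T, 2 * pathExpect D d η δ ℓ T (fun I => ∑ i,
        prob D d η δ ℓ I s v i / observeProb D (prob D d η δ ℓ I s) v i) := by
  refine sum_range_shift_le hv (fun s _ => ?_) (fun t ht => ?_) fun s hs => ?_
  · exact mul_nonneg zero_le_two (pathExpect_nonneg hδ fun I => Finset.sum_nonneg fun i _ =>
      div_nonneg (prob_pos D d η hδ ℓ I s v i).le (observeProb_pos hD hδ s v i).le)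
  · simp only [lossEst_of_lt _ ht]
    simpa using pathExpect_const (D := D) (d := d) (η := η) (ℓ := ℓ) (T := T) hδ 0
  · rw [pathExpect_sum, Finset.sum_congr rfl fun i _ =>
      pathExpect_prob_mul_lossEst_sq (ℓ := ℓ) (η := η) hD hδ (by omega : s < T) v i,
      ← pathExpect_sum, ← pathExpect_mul_left]
    refine pathExpect_mono hδ fun I => ?_
    rw [Finset.mul_sum]
    refine Finset.sum_le_sum fun i _ => ?_
    rw [mul_div_assoc']
    have h1 := (observeProb_pos (d := d) (η := η) (ℓ := ℓ) (I := I) hD hδ s v i).le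
    refine div_le_div_of_nonneg_right ?_ h1
    exact (mul_le_of_le_one_right (prob_pos D d η hδ ℓ I _ v i).le
      (pow_le_one₀ (hℓ s i).1 (hℓ s i).2)).trans (hstab I s v i)

/-- Bound on the expected loss of a single agent. -/
theorem pathExpect_loss_le (hD : ∀ v, D.Adj v v) (hη : 0 < η) (hδ : 0 < δ)
    (hℓ : ∀ t i, ℓ t i ∈ Set.Icc (0 : ℝ) 1)
    (hstab : ∀ I s v i, prob D d η δ ℓ I (s + d v) v i ≤ 2 * prob D d η δ ℓ I s v i)
    {v : V} (hv : d v ≤ T) (k : A) :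
    pathExpect D d η δ ℓ T (fun I => ∑ t ∈ Finset.range T, ℓ t (I t v)) ≤
      ∑ t ∈ Finset.range T, ℓ t k + d v + T * (d v * (δ + η)) +
        (Real.log (Fintype.card A) + T * δ) / η +
        2 * η * ∑ s ∈ Finset.range T, pathExpect D d η δ ℓ T (fun I => ∑ i,
          prob D d η δ ℓ I s v i / observeProb D (prob D d η δ ℓ I s) v i) := by
  have h1 : pathExpect D d η δ ℓ T (fun I => ∑ t ∈ Finset.range T, ℓ t (I t v)) =
      ∑ t ∈ Finset.range T, pathExpect D d η δ ℓ T
        (fun I => ∑ i, prob D d η δ ℓ I t v i * ℓ t i) := by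
    rw [pathExpect_sum]
    exact Finset.sum_congr rfl fun t ht =>
      pathExpect_apply hδ (Finset.mem_range.1 ht) v (ℓ t)
  have h2 := sum_range_le_sum_shift (T := T)
    (f := fun t => pathExpect D d η δ ℓ T (fun I => ∑ i, prob D d η δ ℓ I t v i * ℓ t i))
    (g := fun t => pathExpect D d η δ ℓ T
        (fun I => ∑ i, prob D d η δ ℓ I t v i * lossEst D d η δ ℓ I t v i))
    (c := d v * (δ + η)) hv (by positivity)
    (fun s _ => (pathExpect_mono hδ fun I => sum_prob_mul_le_one hδ hℓ I s s v).trans_eq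
      (pathExpect_const hδ 1))
    (fun t _ => pathExpect_nonneg hδ fun I => Finset.sum_nonneg fun i _ =>
      mul_nonneg (prob_pos D d η hδ ℓ I t v i).le (lossEst_nonneg hD hδ hℓ t v i))
    (fun s hs => pathExpect_drift_le hD hη hδ hℓ hs)
  have h3 := pathExpect_mono (D := D) (d := d) (η := η) (ℓ := ℓ) (T := T) hδ
    fun I => sum_prob_mul_lossEst_le (d := d) (I := I) hD hη hδ hℓ T v k
  rw [pathExpect_sub, pathExpect_mul_left, pathExpect_mul_left, pathExpect_add, pathExpect_add,
    pathExpect_mul_left, pathExpect_const hδ, pathExpect_const hδ, pathExpect_sum, pathExpect_sum,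
    pathExpect_sum] at h3
  have h4 := sum_pathExpect_lossEst_le (η := η) hD hδ hℓ hv k
  have h5 := sum_pathExpect_lossEst_sq_le hD hδ hℓ hstab hv
  rw [← Finset.mul_sum] at h5
  set B := ∑ t ∈ Finset.range T, pathExpect D d η δ ℓ T
        (fun I => ∑ i, prob D d η δ ℓ I t v i * lossEst D d η δ ℓ I t v i)
  set X := ∑ s ∈ Finset.range T, pathExpect D d η δ ℓ T (fun I => ∑ i,
          prob D d η δ ℓ I s v i / observeProb D (prob D d η δ ℓ I s) v i)
  have h6 : B ≤ (Real.log (Fintype.card A) + T * δ) / η + ∑ t ∈ Finset.range T, ℓ t k +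
      2 * η * X := by
    have h7 : η * B ≤ (Real.log (Fintype.card A) + T * δ) + η * ∑ t ∈ Finset.range T, ℓ t k +
        η * (2 * η * X) := by
      nlinarith [mul_le_mul_of_nonneg_left h4 hη.le, mul_le_mul_of_nonneg_left h5 (sq_nonneg η)]
    have h8 : η * ((Real.log (Fintype.card A) + T * δ) / η) =
        Real.log (Fintype.card A) + T * δ := by field_simp
    refine le_of_mul_le_mul_left ?_ hη
    rw [mul_add, mul_add, h8]
    exact h7
  rw [h1]
  linarith

omit [DecidableEq V] in
theorem sum_sum_prob_div_observeProb_le [Nonempty V] (hD : ∀ v, D.Adj v v) (hδ : 0 < δ)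
    (hδ1 : δ ≤ 1) (I : ℕ → V → A) (s : ℕ) :
    ∑ v, ∑ i, prob D d η δ ℓ I s v i / observeProb D (prob D d η δ ℓ I s) v i ≤
      Fintype.card V + Fintype.card A * (2 * digraphIndepNum D *
        (1 + Real.log (2 * Fintype.card V * Fintype.card A / δ))) := by
  have hK : (0 : ℝ) < Fintype.card A := by exact_mod_cast Fintype.card_pos
  -- Lower bound for all probabilities: `δ ≤ 1` gives `1 / (1 + δ) ≥ 1 / 2`.
  have hε : 0 < δ / (2 * Fintype.card A) := by positivity
  have hp : ∀ v i, δ / (2 * Fintype.card A) ≤ prob D d η δ ℓ I s v i := fun v i => by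
    refine le_trans ?_ (le_prob hδ s v i)
    rw [div_div]
    exact div_le_div_of_nonneg_left hδ.le (by positivity) (by nlinarith)
  rw [Finset.sum_comm]
  calc _ ≤ ∑ i, (∑ v, prob D d η δ ℓ I s v i + 2 * digraphIndepNum D *
          (1 + Real.log (Fintype.card V / (δ / (2 * Fintype.card A))))) :=
        Finset.sum_le_sum fun i _ =>
          sum_div_observeProb_le D hD hε hp (fun v i => prob_le_one hδ s v i) i
    _ = _ := by
        rw [Finset.sum_add_distrib, Finset.sum_comm,
          Finset.sum_congr rfl fun v _ => sum_prob D d η hδ ℓ I s v]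
        have : (Fintype.card V : ℝ) / (δ / (2 * Fintype.card A)) =
            2 * Fintype.card V * Fintype.card A / δ := by field_simp
        rw [this]
        simp

theorem welfareRegret_le [Nonempty V] (hD : ∀ v, D.Adj v v) (hη : 0 < η) (hδ : 0 < δ)
    (hδ1 : δ ≤ 1) (hℓ : ∀ t i, ℓ t i ∈ Set.Icc (0 : ℝ) 1)
    (hstab : ∀ I s v i, prob D d η δ ℓ I (s + d v) v i ≤ 2 * prob D d η δ ℓ I s v i)
    (hd : ∀ v, d v ≤ T) :
    welfareRegret D d η δ ℓ T ≤
      avgDelay d * (1 + T * (δ + η)) + (Real.log (Fintype.card A) + T * δ) / η +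
        2 * η * T * (1 + Fintype.card A / Fintype.card V * (2 * digraphIndepNum D *
          (1 + Real.log (2 * Fintype.card V * Fintype.card A / δ)))) := by
  have hN : (0 : ℝ) < Fintype.card V := by exact_mod_cast Fintype.card_pos
  obtain ⟨k, hk⟩ := exists_eq_ciInf_of_finite (f := fun i : A => ∑ t ∈ Finset.range T, ℓ t i)
  have hloss : ∀ v, expect D d η δ ℓ T (fun a => ∑ t : Fin T, ℓ t (a t v)) =
      pathExpect D d η δ ℓ T (fun I => ∑ t ∈ Finset.range T, ℓ t (I t v)) := fun v => by
    rw [pathExpect]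
    congr 1
    funext a
    rw [← Fin.sum_univ_eq_sum_range (fun t => ℓ t (extend a t v))]
    refine Finset.sum_congr rfl fun t _ => ?_
    simp [extend]
  set Y : ℝ := Fintype.card A * (2 * digraphIndepNum D *
        (1 + Real.log (2 * Fintype.card V * Fintype.card A / δ))) with hY
  have hX : ∑ v, ∑ s ∈ Finset.range T, pathExpect D d η δ ℓ T (fun I => ∑ i,
      prob D d η δ ℓ I s v i / observeProb D (prob D d η δ ℓ I s) v i) ≤
      T * (Fintype.card V + Y) := by
    rw [Finset.sum_comm]
    calc _ ≤ ∑ _s ∈ Finset.range T, (Fintype.card V + Y : ℝ) := by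
          refine Finset.sum_le_sum fun s _ => ?_
          rw [← pathExpect_sum]
          exact (pathExpect_mono hδ fun I =>
            sum_sum_prob_div_observeProb_le hD hδ hδ1 I s).trans_eq (pathExpect_const hδ _)
      _ = _ := by rw [Finset.sum_const, Finset.card_range, nsmul_eq_mul]
  have hsum := Finset.sum_le_sum fun v (_ : v ∈ Finset.univ) =>
    pathExpect_loss_le hD hη hδ hℓ hstab (hd v) k
  simp only [Finset.sum_add_distrib, ← Finset.mul_sum, Finset.sum_const, Finset.card_univ,
    nsmul_eq_mul, ← Finset.sum_mul] at hsum
  rw [welfareRegret, ← hk, Finset.sum_congr rfl fun v _ => hloss v, avgDelay, sub_le_iff_le_add,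
    one_div_mul_eq_div, div_le_iff₀ hN]
  refine hsum.trans ?_
  have hX' := mul_le_mul_of_nonneg_left hX (by positivity : 0 ≤ 2 * η)
  refine (add_le_add_right hX' _).trans (le_of_eq ?_)
  rw [hY]
  field_simp
  ring

theorem welfareRegret_eq_zero [Nonempty V] [Subsingleton A] (hδ : 0 < δ) :
    welfareRegret D d η δ ℓ T = 0 := by
  have hN : (Fintype.card V : ℝ) ≠ 0 := by exact_mod_cast Fintype.card_ne_zero
  have i₀ : A := Classical.arbitrary A
  have h1 : ∀ v, expect D d η δ ℓ T (fun a => ∑ t : Fin T, ℓ t (a t v)) =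
      ∑ t ∈ Finset.range T, ℓ t i₀ := fun v => by
    have h : ∀ a : Fin T → V → A, ∑ t : Fin T, ℓ t (a t v) = ∑ t ∈ Finset.range T, ℓ t i₀ :=
      fun a => by
        rw [← Fin.sum_univ_eq_sum_range (fun t => ℓ t i₀)]
        exact Finset.sum_congr rfl fun t _ => by rw [Subsingleton.elim (a t v) i₀]
    simp only [h]
    exact pathExpect_const hδ _
  have h2 : ⨅ i : A, ∑ t ∈ Finset.range T, ℓ t i = ∑ t ∈ Finset.range T, ℓ t i₀ := by
    rw [← ciInf_const (ι := A) (a := ∑ t ∈ Finset.range T, ℓ t i₀)]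
    congr 1
    funext i
    rw [Subsingleton.elim i i₀]
  rw [welfareRegret, h2, Finset.sum_congr rfl fun v _ => h1 v]
  simp only [Finset.sum_const, Finset.card_univ, nsmul_eq_mul]
  field_simp
  ring

end Regret

/-! ### Absorbing constants for large `T` -/

theorem commDigraph_adj_self {V : Type*} (G : SimpleGraph V) (d ttl : V → ℕ) (v : V) :
    (commDigraph G d ttl).Adj v v := by
  simp [commDigraph]

theorem avgDelay_nonneg {V : Type*} [Fintype V] (d : V → ℕ) : 0 ≤ avgDelay d := by
  unfold avgDelay
  positivity

/-- The lone delay `2 Δ` is absorbed through `Δ η ≤ log 2 ≤ κ`, the `1 / η` through `1 ≤ 2 κ`, and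
the 1 in the last bracket through `1 ≤ β L`. The total is 5 times `κ / η`, once `η Δ T`, and 10
times `η β L T`. -/
theorem le_ten_mul_of_le {η T κ Δ β L L' r : ℝ} (hη : 0 < η) (hT : 0 ≤ T)
    (hκ : Real.log 2 ≤ κ) (hΔ : 0 ≤ Δ) (hΔη : Δ * η ≤ Real.log 2) (hβ : 0 ≤ β)
    (hβL : 1 ≤ β * L) (hL : 1 + L' ≤ 2 * L)
    (hr : r ≤ Δ * (2 + T * η) + (κ + 1) / η + 2 * η * T * (1 + 2 * β * (1 + L'))) :
    r ≤ 10 * (κ / η + η * (Δ + β * L) * T) := by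
  have hlog2 : (1 : ℝ) / 2 < Real.log 2 := by linarith [Real.log_two_gt_d9]
  have h1 : Δ ≤ κ / η := by
    rw [le_div_iff₀ hη]
    linarith
  have h2 : (κ + 1) / η ≤ 3 * (κ / η) := by
    rw [mul_div_assoc']
    gcongr
    linarith
  have h3 : 2 * η * T * (1 + 2 * β * (1 + L')) ≤ 2 * η * T * (5 * (β * L)) := by
    have := mul_le_mul_of_nonneg_left hL hβ
    refine mul_le_mul_of_nonneg_left ?_ (by positivity)
    linarith
  have h4 : 0 ≤ κ / η := div_nonneg (by linarith) hη.le
  have h5 : 0 ≤ Δ * T * η := by positivity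
  linarith

end Exp3Coop2

open Exp3Coop2 in
theorem Exp3Coop2.eventually_welfareRegret_le (K N : ℕ) [NeZero K] [NeZero N] (hK : 2 ≤ K)
    (G : SimpleGraph (Fin N)) (d ttl : Fin N → ℕ) (η : ℕ → ℝ) (hη : ∀ T, 0 < η T)
    (hη0 : Tendsto η atTop (𝓝 0)) :
    ∀ᶠ T : ℕ in atTop, ∀ ℓ : ℕ → Fin K → ℝ, (∀ t i, ℓ t i ∈ Set.Icc (0 : ℝ) 1) →
      welfareRegret (commDigraph G d ttl) d (η T) (1 / (T : ℝ)) ℓ T ≤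
        10 * (Real.log K / η T + η T * (avgDelay d + (K : ℝ) / (N : ℝ) *
          (digraphIndepNum (commDigraph G d ttl) : ℝ) * Real.log ((T : ℝ) * N * K)) * T) := by
  set D := commDigraph G d ttl with hDdef
  have hD : ∀ v, D.Adj v v := commDigraph_adj_self G d ttl
  have hN1 : (1 : ℝ) ≤ N := by exact_mod_cast NeZero.one_le
  have hK2 : (2 : ℝ) ≤ K := by exact_mod_cast hK
  have hα : (1 : ℝ) ≤ digraphIndepNum D := by exact_mod_cast one_le_digraphIndepNum D
  set M := Finset.univ.sup d with hM
  have hdM : ∀ v, d v ≤ M := fun v => Finset.le_sup (Finset.mem_univ v)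
  -- The `+ 1` keeps `ρ` finite and at most 1 when all delays vanish.
  set ρ : ℝ := 1 / (2 * (M + 1)) with hρ
  have hρ0 : 0 < ρ := by positivity
  have hρ1 : ρ ≤ 1 := by
    rw [hρ, div_le_one (by positivity)]
    linarith [Nat.cast_nonneg (α := ℝ) M]
  have hMρ : 2 * M * ρ ≤ 1 := by
    rw [hρ, mul_one_div, div_le_one (by positivity)]
    linarith
  have hlog2 : 0 < Real.log 2 := Real.log_pos one_lt_two
  have hη1 : Tendsto (fun T => η T * (2 * K)) atTop (𝓝 0) := by
    simpa using hη0.mul_const (2 * (K : ℝ))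
  have hη2 : Tendsto (fun T => avgDelay d * η T) atTop (𝓝 0) := by
    simpa using hη0.const_mul (avgDelay d)
  have hlogT : Tendsto (fun T : ℕ => Real.log T) atTop atTop :=
    Real.tendsto_log_atTop.comp tendsto_natCast_atTop_atTop
  -- None of these thresholds involves the losses. In order they give delays within the horizon,
  -- stability in `η`, absorption of the average delay, a logarithm of at least `N` and 2, and
  -- stability in `δ`.
  filter_upwards [eventually_ge_atTop (max M 1), hη1.eventually_le_const hρ0,
    hη2.eventually_le_const hlog2, hlogT.eventually_ge_atTop (max N 2),
    tendsto_one_div_atTop_nhds_zero_nat.eventually_le_const hρ0]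
    with T hT hηρ hΔη hlog hδρ ℓ hℓ
  have hT1 : (1 : ℝ) ≤ T := by exact_mod_cast (le_max_right _ _).trans hT
  have hT0 : (0 : ℝ) < T := by linarith
  have hδ : (0 : ℝ) < 1 / T := by positivity
  have hstab : ∀ I s v i, prob D d (η T) (1 / (T : ℝ)) ℓ I (s + d v) v i ≤
      2 * prob D d (η T) (1 / (T : ℝ)) ℓ I s v i := fun I s v i =>
    prob_add_le_two_mul hD (hη T) hδ hℓ hρ1 hMρ hdM hδρ (by simpa using hηρ) s v i
  have hr := welfareRegret_le hD (hη T) hδ (hδρ.trans hρ1) hℓ hstab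
    fun v => (hdM v).trans ((le_max_left _ _).trans hT)
  simp only [Fintype.card_fin] at hr
  have hlogle : Real.log T ≤ Real.log ((T : ℝ) * N * K) := by
    refine Real.log_le_log hT0 ?_
    rw [mul_assoc]
    exact le_mul_of_one_le_right hT0.le (one_le_mul_of_one_le_of_one_le hN1 (by linarith))
  have hlogN : (N : ℝ) ≤ Real.log ((T : ℝ) * N * K) :=
    (le_max_left _ _).trans (hlog.trans hlogle)
  have hlogtwo : 2 ≤ Real.log ((T : ℝ) * N * K) := (le_max_right _ _).trans (hlog.trans hlogle)
  have hX1 : 1 ≤ (K : ℝ) / N * digraphIndepNum D * Real.log ((T : ℝ) * N * K) := by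
    rw [div_mul_eq_mul_div, div_mul_eq_mul_div, one_le_div (by linarith)]
    refine hlogN.trans (le_mul_of_one_le_left (by linarith) ?_)
    exact one_le_mul_of_one_le_of_one_le (by linarith) hα
  have hlog' : 1 + Real.log (2 * N * K / (1 / (T : ℝ))) ≤ 2 * Real.log ((T : ℝ) * N * K) := by
    have : (2 * N * K / (1 / (T : ℝ))) = 2 * ((T : ℝ) * N * K) := by field_simp
    rw [this, Real.log_mul two_ne_zero (by positivity)]
    linarith [Real.log_two_lt_d9]
  refine le_ten_mul_of_le (hη T) hT0.le (Real.log_le_log two_pos hK2) (avgDelay_nonneg d) hΔη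
    (by positivity) hX1 hlog' (hr.trans (le_of_eq ?_))
  have h1 : (T : ℝ) * (1 / T) = 1 := mul_one_div_cancel hT0.ne'
  rw [mul_add (T : ℝ), h1]
  ring

theorem theoremt :
    ∃ C : ℝ, 0 < C ∧
      ∀ (K N : ℕ) [NeZero K] [NeZero N] (G : SimpleGraph (Fin N)) (d ttl : Fin N → ℕ)
        (η : ℕ → ℝ), (∀ T, 0 < η T) → Tendsto η atTop (𝓝 0) →
        ∀ᶠ T : ℕ in atTop, ∀ ℓ : ℕ → Fin K → ℝ, (∀ t i, ℓ t i ∈ Set.Icc (0 : ℝ) 1) →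
          Exp3Coop2.welfareRegret (Exp3Coop2.commDigraph G d ttl) d (η T) (1 / (T : ℝ)) ℓ T ≤
            C * (Real.log K / η T +
              η T * (Exp3Coop2.avgDelay d +
                (K : ℝ) / (N : ℝ) *
                  (Exp3Coop2.digraphIndepNum (Exp3Coop2.commDigraph G d ttl) : ℝ) *
                  Real.log ((T : ℝ) * N * K)) * T) := by
  refine ⟨10, by norm_num, fun K N _ _ G d ttl η hη hη0 => ?_⟩
  rcases Nat.lt_or_ge 1 K with hK | hK
  · exact Exp3Coop2.eventually_welfareRegret_le K N hK G d ttl η hη hη0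
  -- Here `log K = 0` cannot absorb the `T δ / η = 1 / η` of the general bound, so the regret is
  -- computed exactly.
  · obtain rfl : K = 1 := le_antisymm hK NeZero.one_le
    filter_upwards [eventually_ge_atTop 1] with T hT ℓ hℓ
    have hT1 : (1 : ℝ) ≤ T := by exact_mod_cast hT
    have hN1 : (1 : ℝ) ≤ N := by exact_mod_cast NeZero.one_le
    rw [Exp3Coop2.welfareRegret_eq_zero (by positivity)]
    have h1 : 0 ≤ Real.log ((T : ℝ) * N * (1 : ℕ)) := Real.log_nonneg (by
      rw [Nat.cast_one, mul_one]
      exact one_le_mul_of_one_le_of_one_le hT1 hN1)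
    have h2 := Exp3Coop2.avgDelay_nonneg d
    have h3 := hη T
    have h4 : Real.log ((1 : ℕ) : ℝ) = 0 := by simp
    rw [h4]
    positivity
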